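/- Let $K$ be a field of characteristic zero, $\delta\in K$ with $\delta\neq 0$, and $r\ge 0$ an integer. Let $B_r=B_r(\delta)$ be the Brauer algebra over $K$: its basis consists of the diagrams (perfect matchings) on $r$ top and $r$ bottom nodes, and the product of two diagrams is their concatenation, in which every closed loop is replaced by a factor $\delta$. A through string of a diagram is a string that joins a top node to a bottom node. For an integer $m\ge 0$ let $B_r^m$ be the two-sided ideal of $B_r$ spanned by the diagrams with at most $m$ through strings. Let $\lambda$ be a partition of an integer $t$ with $0\le t\le r$ and $t\equiv r \pmod 2$. Let $S(\lambda)=K\mathrm{Sym}_t\,c_\lambda$ be the Specht module, where $c_\lambda=b_\lambda a_\lambda$ is the Young symmetrizer of some bijective tableau of shape $\lambda$ ($a_\lambda$ is the sum of the row permutations, $b_\lambda$ the signed sum of the column permutations), with the invariant symmetric form $(\cdot,\cdot)_S$ obtained by restricting the form on $K\mathrm{Sym}_t$ for which the group elements are orthonormal. Let $I_r^t$ be the $(B_r,K\mathrm{Sym}_t)$-bimodule spanned by the diagrams with $r$ top and $t$ bottom nodes, modulo the span of those with fewer than $t$ through strings. The cell module of $B_r$ is $$W_r(\lambda)=I_r^t\otimes_{K\mathrm{Sym}_t}S(\lambda).$$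 Its canonical bilinear form is $(x\otimes u,\,y\otimes v)_\lambda=(u,\langle x,y\rangle v)_S$, where, for diagrams $x,y$, the element $\langle x,y\rangle\in K\mathrm{Sym}_t$ is the concatenation $x^*y$ of the reflected diagram $x^*$ with $y$ (with a factor $\delta$ for each closed loop) if it has $t$ through strings, and $0$ otherwise. Let $\mathrm{Rad}_r(\lambda)=\{w\in W_r(\lambda)\mid (w,v)_\lambda=0\text{ for all }v\in W_r(\lambda)\}$ be the radical of this form. Then $$\mathrm{Rad}_r(\lambda)=\{w\in W_r(\lambda)\mid bw=0\text{ for all }b\in B_r^t\}=\mathrm{Ann}_{W_r(\lambda)}(B_r^t).$$ -/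

import Mathlib

namespace BrauerCell

/-! ### Equivalence relations -/

section SetoidFacts

variable {X Y Z : Type*}

theorem map_rel {f : Y → X} (hf : f.Injective) (r : Setoid Y) (x y : X) :
    r.map f x y ↔ x = y ∨ ∃ a b, f a = x ∧ f b = y ∧ r a b := by
  constructor
  · intro h
    change Relation.EqvGen _ x y at h
    induction h with
    | rel x y h =>
      obtain ⟨a, b, h1, h2, h3⟩ := h
      exact Or.inr ⟨a, b, by tauto⟩
    | refl x => exact Or.inl rfl
    | symm x y _ ih =>
      rcases ih with rfl | ⟨a, b, h1, h2, h3⟩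
      · exact Or.inl rfl
      · exact Or.inr ⟨b, a, h2, h1, r.symm' h3⟩
    | trans x y z _ _ ih1 ih2 =>
      rcases ih1 with rfl | ⟨a, b, h1, h2, h3⟩
      · exact ih2
      · rcases ih2 with rfl | ⟨c, d, h4, h5, h6⟩
        · exact Or.inr ⟨a, b, h1, h2, h3⟩
        · obtain rfl : b = c := hf (h2.trans h4.symm)
          exact Or.inr ⟨a, d, h1, h5, r.trans' h3 h6⟩
  · rintro (rfl | ⟨a, b, rfl, rfl, h⟩)
    · exact Setoid.refl' _ _
    · exact Setoid.le_comap_map h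

theorem map_le_iff (f : Y → X) (r : Setoid Y) (s : Setoid X) :
    r.map f ≤ s ↔ r ≤ s.comap f := by
  constructor
  · intro h x y hxy
    exact h (Setoid.le_comap_map hxy)
  · intro h x y hxy
    change Relation.EqvGen _ x y at hxy
    induction hxy with
    | rel x y h' =>
      obtain ⟨a, b, h1, rfl, rfl⟩ := h'
      exact h h1
    | refl x => exact s.refl' x
    | symm x y _ ih => exact s.symm' ih
    | trans x y z _ _ ih1 ih2 => exact s.trans' ih1 ih2

theorem map_gc (f : Y → X) : GaloisConnection (fun r : Setoid Y => r.map f) (Setoid.comap f) :=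
  fun r s => map_le_iff f r s

theorem map_sup (f : Y → X) (r s : Setoid Y) : (r ⊔ s).map f = r.map f ⊔ s.map f :=
  (map_gc f).l_sup

theorem map_map (f : Y → X) (g : Z → Y) (r : Setoid Z) : (r.map g).map f = r.map (f ∘ g) := by
  apply le_antisymm
  · rw [map_le_iff, map_le_iff, ← Setoid.comap_comp, ← map_le_iff]
  · rw [map_le_iff, Setoid.comap_comp, ← map_le_iff, ← map_le_iff]

/-- If `s` only relates points in the range of `f`, then restricting along `f` commutes with
joining with `s`. -/
theorem comap_sup (f : Y → X) (r s : Setoid X)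
    (hs : ∀ x y, s x y → x = y ∨ (x ∈ Set.range f ∧ y ∈ Set.range f)) :
    (r ⊔ s).comap f = r.comap f ⊔ s.comap f := by
  apply le_antisymm
  · have key : ∀ x y, (r ⊔ s) x y → ∀ a, (∃ b, (r.comap f ⊔ s.comap f) a b ∧ r (f b) x) →
        ∃ b, (r.comap f ⊔ s.comap f) a b ∧ r (f b) y := by
      intro x y h
      rw [Setoid.sup_eq_eqvGen] at h
      have h' : ∀ x y, (r x y ∨ s x y) → ∀ a, (∃ b, (r.comap f ⊔ s.comap f) a b ∧ r (f b) x) →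
        ∃ b, (r.comap f ⊔ s.comap f) a b ∧ r (f b) y := by
        rintro x y (h | h) a ⟨b, hb, hx⟩
        · exact ⟨b, hb, r.trans' hx h⟩
        · rcases hs x y h with rfl | ⟨⟨c, rfl⟩, ⟨d, rfl⟩⟩
          · exact ⟨b, hb, hx⟩
          · refine ⟨d, ?_, r.refl' _⟩
            have h1 : (r.comap f ⊔ s.comap f) b c :=
              (le_sup_left : r.comap f ≤ _) hx
            have h2 : (r.comap f ⊔ s.comap f) c d :=
              (le_sup_right : s.comap f ≤ _) h
            exact Setoid.trans' _ hb (Setoid.trans' _ h1 h2)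
      have h2 : ∀ a, (∃ b, (r.comap f ⊔ s.comap f) a b ∧ r (f b) x) ↔
        ∃ b, (r.comap f ⊔ s.comap f) a b ∧ r (f b) y := by
        change Relation.EqvGen _ x y at h
        induction h with
        | rel x y h =>
          refine fun a => ⟨h' x y h a, h' y x ?_ a⟩
          exact h.imp r.symm' s.symm'
        | refl x => exact fun a => Iff.rfl
        | symm x y _ ih => exact fun a => (ih a).symm
        | trans x y z _ _ ih1 ih2 => exact fun a => (ih1 a).trans (ih2 a)
      exact fun a => (h2 a).1
    intro x y h
    obtain ⟨b, hb, hy⟩ := key _ _ h x ⟨x, Setoid.refl' _ _, r.refl' _⟩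
    exact Setoid.trans' _ hb ((le_sup_left : r.comap f ≤ _) hy)
  · exact sup_le (fun x y h => (le_sup_left : r ≤ r ⊔ s) h)
      (fun x y h => (le_sup_right : s ≤ r ⊔ s) h)

/-- The number of classes of `s` that are contained in `P`. -/
noncomputable def classesIn (s : Setoid X) (P : Set X) : ℕ :=
  Set.ncard {c : Set X | c ∈ s.classes ∧ c ⊆ P}

theorem classesIn_map {f : Y → X} (hf : f.Injective) (r : Setoid Y) (P : Set Y) :
    classesIn (r.map f) (f '' P) = classesIn r P := by
  have hcl : ∀ a : Y, {x | r.map f x (f a)} = f '' {b | r b a} := by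
    intro a
    ext x
    simp only [Set.mem_ofPred_eq, Set.mem_image, map_rel hf]
    constructor
    · rintro (rfl | ⟨b, c, rfl, h2, h3⟩)
      · exact ⟨a, r.refl' _, rfl⟩
      · exact ⟨b, hf h2 ▸ h3, rfl⟩
    · rintro ⟨b, h, rfl⟩
      exact Or.inr ⟨b, a, rfl, rfl, h⟩
  have : {c : Set X | c ∈ (r.map f).classes ∧ c ⊆ f '' P} =
      Set.image f '' {c : Set Y | c ∈ r.classes ∧ c ⊆ P} := by
    ext c
    constructor
    · rintro ⟨⟨x, rfl⟩, hP⟩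
      obtain ⟨a, -, rfl⟩ := hP (show (r.map f) x x from Setoid.refl' _ _)
      rw [hcl] at hP ⊢
      exact ⟨_, ⟨⟨a, rfl⟩, (Set.image_subset_image_iff hf).1 hP⟩, rfl⟩
    · rintro ⟨c, ⟨⟨a, rfl⟩, hP⟩, rfl⟩
      exact ⟨⟨f a, (hcl a).symm⟩, Set.image_mono hP⟩
  rw [classesIn, classesIn, this, Set.ncard_image_of_injective _ hf.image_injective]

theorem classesIn_sup [Finite X] (f : Y → X) (r s : Setoid X)
    (hs : ∀ x y, s x y → x = y ∨ (x ∈ Set.range f ∧ y ∈ Set.range f))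
    (P : Set X) (hP : (Set.range f)ᶜ ⊆ P) :
    classesIn (r ⊔ s) P = classesIn r (Set.range f)ᶜ + classesIn ((r ⊔ s).comap f) (f ⁻¹' P) := by
  have hsup : ∀ x y, (r ⊔ s) x y → ∀ (hx : ∀ z, r z x → z ∉ Set.range f), r x y := by
    intro x y h
    rw [Setoid.sup_eq_eqvGen] at h
    have : (∀ z, r z x → z ∉ Set.range f) ∨ (∀ z, r z y → z ∉ Set.range f) → r x y := by
      change Relation.EqvGen _ x y at h
      induction h with
      | rel x y h =>
        rintro h'
        rcases h with h | h
        · exact h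
        · rcases hs x y h with rfl | ⟨h1, h2⟩
          · exact r.refl' _
          · rcases h' with h' | h'
            · exact absurd h1 (h' x (r.refl' _))
            · exact absurd h2 (h' y (r.refl' _))
      | refl x => exact fun _ => r.refl' _
      | symm x y _ ih => exact fun h => r.symm' (ih h.symm)
      | trans x y z _ _ ih1 ih2 =>
        rintro (h | h)
        · have h1 := ih1 (Or.inl h)
          exact r.trans' h1 (ih2 (Or.inl fun w hw => h w (r.trans' hw (r.symm' h1))))
        · have h1 := ih2 (Or.inr h)
          exact r.trans' (ih1 (Or.inr fun w hw => h w (r.trans' hw h1))) h1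
    exact fun hx => this (Or.inl hx)
  have hA : {c : Set X | c ∈ (r ⊔ s).classes ∧ c ⊆ (Set.range f)ᶜ} =
      {c : Set X | c ∈ r.classes ∧ c ⊆ (Set.range f)ᶜ} := by
    ext c
    constructor
    · rintro ⟨⟨x, rfl⟩, h⟩
      have : {y | (r ⊔ s) y x} = {y | r y x} := by
        ext y
        refine ⟨fun hy => ?_, fun hy => (le_sup_left : r ≤ r ⊔ s) hy⟩
        exact r.symm' (hsup x y (Setoid.symm' _ hy)
          fun z hz => h ((le_sup_left : r ≤ r ⊔ s) hz))
      exact ⟨⟨x, this⟩, h⟩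
    · rintro ⟨⟨x, rfl⟩, h⟩
      have : {y | r y x} = {y | (r ⊔ s) y x} := by
        ext y
        refine ⟨fun hy => (le_sup_left : r ≤ r ⊔ s) hy, fun hy => ?_⟩
        exact r.symm' (hsup x y (Setoid.symm' _ hy) fun z hz => h hz)
      exact ⟨⟨x, this⟩, h⟩
  have hB : {c : Set Y | c ∈ ((r ⊔ s).comap f).classes ∧ c ⊆ f ⁻¹' P} =
      Set.preimage f '' {c : Set X | c ∈ (r ⊔ s).classes ∧ c ⊆ P ∧ ¬ c ⊆ (Set.range f)ᶜ} := by
    ext c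
    constructor
    · rintro ⟨⟨a, rfl⟩, h⟩
      refine ⟨{x | (r ⊔ s) x (f a)}, ⟨⟨f a, rfl⟩, ?_, ?_⟩, rfl⟩
      · intro x hx
        by_cases hxf : x ∈ Set.range f
        · obtain ⟨b, rfl⟩ := hxf
          exact h hx
        · exact hP hxf
      · exact fun h' => h' (show (r ⊔ s) (f a) (f a) from Setoid.refl' _ _) ⟨a, rfl⟩
    · rintro ⟨c, ⟨⟨x, rfl⟩, h1, h2⟩, rfl⟩
      rw [Set.not_subset] at h2
      obtain ⟨y, hy, hyf⟩ := h2
      rw [Set.notMem_compl_iff] at hyf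
      obtain ⟨a, rfl⟩ := hyf
      refine ⟨⟨a, ?_⟩, fun b hb => h1 hb⟩
      ext b
      exact ⟨fun hb => (r ⊔ s).trans' hb ((r ⊔ s).symm' hy),
        fun hb => (r ⊔ s).trans' hb hy⟩
  have hinj : Set.InjOn (Set.preimage f)
      {c : Set X | c ∈ (r ⊔ s).classes ∧ c ⊆ P ∧ ¬ c ⊆ (Set.range f)ᶜ} := by
    rintro c ⟨hc, -, hc2⟩ d ⟨hd, -, -⟩ hcd
    rw [Set.not_subset] at hc2
    obtain ⟨y, hy, hyf⟩ := hc2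
    rw [Set.notMem_compl_iff] at hyf
    obtain ⟨a, rfl⟩ := hyf
    have : a ∈ f ⁻¹' d := hcd ▸ hy
    exact Setoid.eq_of_mem_classes hc hy hd this
  have hC : {c : Set X | c ∈ (r ⊔ s).classes ∧ c ⊆ P} =
      {c : Set X | c ∈ (r ⊔ s).classes ∧ c ⊆ (Set.range f)ᶜ} ∪
      {c : Set X | c ∈ (r ⊔ s).classes ∧ c ⊆ P ∧ ¬ c ⊆ (Set.range f)ᶜ} := by
    ext c
    simp only [Set.mem_ofPred_eq, Set.mem_union]
    constructor
    · rintro ⟨h1, h2⟩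
      by_cases h3 : c ⊆ (Set.range f)ᶜ <;> tauto
    · rintro (⟨h1, h2⟩ | ⟨h1, h2, -⟩)
      · exact ⟨h1, h2.trans hP⟩
      · exact ⟨h1, h2⟩
  rw [classesIn, classesIn, classesIn, hB, hinj.ncard_image, hC,
    Set.ncard_union_eq ?_ (Set.toFinite _) (Set.toFinite _), hA]
  rw [Set.disjoint_left]
  rintro c ⟨-, h⟩ ⟨-, -, h'⟩
  exact h' h

end SetoidFacts

/-! ### Two involutions -/

/-- Let `A`, `B` be involutions of a finite set without common fixed points. A fixed point `x` of
`B` is linked, by alternately applying `A` and `B`, to exactly one other point that is fixed by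
`A` or by `B`. -/
theorem involution_walk {X : Type*} [Finite X] (A B : Equiv.Perm X) (hA : A * A = 1)
    (hB : B * B = 1) (hAB : ∀ x, A x = x → B x ≠ x) (J : Setoid X)
    (hJ : J = Relation.EqvGen.setoid fun x y => A x = y ∨ B x = y)
    (x : X) (hx : B x = x) : ∃! y, y ≠ x ∧ (A y = y ∨ B y = y) ∧ J x y := by
  have hA' : A⁻¹ = A := inv_eq_of_mul_eq_one_left hA
  have hB' : B⁻¹ = B := inv_eq_of_mul_eq_one_left hB
  set p : Equiv.Perm X := B * A with hp
  have hApA : ∀ k : ℤ, A * p ^ k = p ^ (-k) * A := by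
    intro k
    have h1 : A * p * A⁻¹ = p⁻¹ := by
      rw [hp, mul_inv_rev, hA', hB', mul_assoc, mul_assoc, hA, mul_one]
    have h2 : A * p ^ k * A⁻¹ = p ^ (-k) := by
      rw [← conj_zpow, h1, inv_zpow', ]
    rw [← h2, inv_mul_cancel_right]
  have hBpB : ∀ k : ℤ, B * p ^ k = p ^ (-k) * B := by
    intro k
    have h1 : B * p * B⁻¹ = p⁻¹ := by
      rw [hp, mul_inv_rev, hA', hB', ← mul_assoc, hB, one_mul]
    have h2 : B * p ^ k * B⁻¹ = p ^ (-k) := by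
      rw [← conj_zpow, h1, inv_zpow']
    rw [← h2, inv_mul_cancel_right]
  have hAx : A x = (p ^ (-1 : ℤ)) x := by
    rw [zpow_neg_one, hp, mul_inv_rev, hA', hB', Equiv.Perm.mul_apply, hx]
  have hAk : ∀ k : ℤ, A ((p ^ k) x) = (p ^ (-k - 1)) x := by
    intro k
    rw [← Equiv.Perm.mul_apply, hApA, Equiv.Perm.mul_apply, hAx, ← Equiv.Perm.mul_apply,
      ← zpow_add]
    rfl
  have hBk : ∀ k : ℤ, B ((p ^ k) x) = (p ^ (-k)) x := by
    intro k
    rw [← Equiv.Perm.mul_apply, hBpB, Equiv.Perm.mul_apply, hx]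
  have hJA : ∀ y, J y (A y) := fun y => by
    rw [hJ]; exact Relation.EqvGen.rel _ _ (Or.inl rfl)
  have hJB : ∀ y, J y (B y) := fun y => by
    rw [hJ]; exact Relation.EqvGen.rel _ _ (Or.inr rfl)
  have horb : ∀ y, J x y ↔ ∃ k : ℤ, y = (p ^ k) x := by
    intro y
    constructor
    · have hstep : ∀ u v, (A u = v ∨ B u = v) →
          ((∃ k : ℤ, u = (p ^ k) x) ↔ ∃ k : ℤ, v = (p ^ k) x) := by
        have hone : ∀ u v, (A u = v ∨ B u = v) → (∃ k : ℤ, u = (p ^ k) x) →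
            ∃ k : ℤ, v = (p ^ k) x := by
          rintro u v (rfl | rfl) ⟨k, rfl⟩
          · exact ⟨_, hAk k⟩
          · exact ⟨_, hBk k⟩
        intro u v h
        refine ⟨hone u v h, hone v u (h.imp ?_ ?_)⟩
        · rintro rfl
          rw [← Equiv.Perm.mul_apply, hA]; rfl
        · rintro rfl
          rw [← Equiv.Perm.mul_apply, hB]; rfl
      intro h
      have : (∃ k : ℤ, x = (p ^ k) x) ↔ ∃ k : ℤ, y = (p ^ k) x := by
        rw [hJ] at h
        change Relation.EqvGen _ x y at h
        clear hJ hJA hJB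
        generalize hz : x = z at h
        have : ∀ u v, Relation.EqvGen (fun x y => A x = y ∨ B x = y) u v →
            ((∃ k : ℤ, u = (p ^ k) x) ↔ ∃ k : ℤ, v = (p ^ k) x) := by
          intro u v h
          induction h with
          | rel u v h => exact hstep u v h
          | refl u => exact Iff.rfl
          | symm u v _ ih => exact ih.symm
          | trans u v w _ _ ih1 ih2 => exact ih1.trans ih2
        subst hz
        exact this _ _ h
      exact this.1 ⟨0, rfl⟩
    · rintro ⟨k, rfl⟩
      have hp1 : ∀ u, J u (p u) := fun u => J.trans' (hJA u) (hJB _)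
      induction k with
      | zero => exact J.refl' _
      | succ k ih =>
        have := hp1 ((p ^ (k : ℤ)) x)
        rw [← Equiv.Perm.mul_apply, ← zpow_one_add, add_comm] at this
        exact J.trans' ih this
      | pred k ih =>
        have := hp1 ((p ^ (-(k : ℤ) - 1)) x)
        rw [← Equiv.Perm.mul_apply, ← zpow_one_add, add_sub_cancel] at this
        exact J.trans' ih (J.symm' this)
  -- the period of `x` under `p`
  set n := Function.minimalPeriod p x with hn
  have hnpos : 0 < n :=
    Function.minimalPeriod_pos_of_mem_periodicPts
      (Function.mem_periodicPts.2 ⟨orderOf p, orderOf_pos p, by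
        rw [Function.IsPeriodicPt, Function.IsFixedPt, ← Equiv.Perm.coe_pow, pow_orderOf_eq_one]
        rfl⟩)
  have hper : ∀ k l : ℤ, (p ^ k) x = (p ^ l) x ↔ (n : ℤ) ∣ k - l := by
    intro k l
    have h1 : ∀ k : ℤ, (p ^ k) x = x ↔ (n : ℤ) ∣ k := fun k => by
      have := MulAction.zpow_smul_eq_iff_minimalPeriod_dvd (a := p) (b := x) (n := k)
      exact this
    rw [← h1, sub_eq_neg_add, zpow_add, Equiv.Perm.mul_apply, zpow_neg, Equiv.Perm.inv_eq_iff_eq]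
  have hnodd : n ≠ 1 := by
    intro h1
    have := (hper (-1) 0).2 (by rw [h1]; simp)
    rw [← hAx] at this
    exact hAB x this hx
  refine ⟨(p ^ ((n / 2 : ℕ) : ℤ)) x, ⟨?_, ?_, (horb _).2 ⟨_, rfl⟩⟩, ?_⟩
  · intro h
    have := (hper _ 0).1 h
    rw [sub_zero, Int.natCast_dvd_natCast] at this
    have := Nat.le_of_dvd (by omega) this
    omega
  · rw [hAk, hBk, hper, hper]
    rcases Nat.even_or_odd' n with ⟨c, hc | hc⟩
    · exact Or.inr ⟨-1, by omega⟩
    · exact Or.inl ⟨-1, by omega⟩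
  · rintro y ⟨hyx, hfix, hxy⟩
    obtain ⟨k, rfl⟩ := (horb y).1 hxy
    have hnk : ¬ (n : ℤ) ∣ k := fun h => hyx ((hper k 0).2 (by simpa using h))
    rw [hAk, hBk, hper, hper] at hfix
    rw [hper]
    rcases Nat.even_or_odd' n with ⟨c, hc | hc⟩
    · have hc2 : n / 2 = c := by omega
      have hcz : (n : ℤ) = 2 * c := by omega
      rw [hc2]
      rcases hfix with ⟨d, hd⟩ | ⟨d, hd⟩
      · rw [hcz, mul_assoc] at hd
        omega
      · rw [hcz, mul_assoc] at hd
        have hk : k = -(c * d) := by omega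
        rcases Int.even_or_odd' d with ⟨e, he | he⟩
        · exact absurd ⟨-e, by rw [hk, he, hcz]; ring⟩ hnk
        · exact ⟨-e - 1, by rw [hk, he, hcz]; ring⟩
    · have hc2 : n / 2 = c := by omega
      have hcz : (n : ℤ) = 2 * c + 1 := by omega
      rw [hc2]
      rcases hfix with ⟨d, hd⟩ | ⟨d, hd⟩
      · rw [hcz] at hd
        rcases Int.even_or_odd' d with ⟨e, rfl | rfl⟩
        · have h1 : (2 * (c : ℤ) + 1) * (2 * e) = 2 * ((2 * c + 1) * e) := by ring
          omega
        · have h1 : (2 * (c : ℤ) + 1) * (2 * e + 1) = 2 * ((2 * c + 1) * e) + 2 * c + 1 := by ring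
          refine ⟨-e - 1, ?_⟩
          have h2 : (2 * (c : ℤ) + 1) * (-e - 1) = -((2 * c + 1) * e) - 2 * c - 1 := by ring
          rw [hcz]
          omega
      · rw [hcz] at hd
        rcases Int.even_or_odd' d with ⟨e, rfl | rfl⟩
        · have h1 : (2 * (c : ℤ) + 1) * (2 * e) = 2 * ((2 * c + 1) * e) := by ring
          refine absurd ⟨-e, ?_⟩ hnk
          have h2 : (2 * (c : ℤ) + 1) * (-e) = -((2 * c + 1) * e) := by ring
          rw [hcz]
          omega
        · have h1 : (2 * (c : ℤ) + 1) * (2 * e + 1) = 2 * ((2 * c + 1) * e) + 2 * c + 1 := by ring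
          omega

/-! ### Brauer diagrams -/

/-- All blocks of the set partition `s` have exactly two elements. -/
def IsPerfectMatching {X : Type*} (s : Setoid X) : Prop :=
  ∀ x, ∃! y, y ≠ x ∧ s x y

/-- Brauer diagrams with a top row of `m` nodes and a bottom row of `n` nodes. -/
structure Diagram (m n : ℕ) where
  /-- The set partition of the nodes into the strings of the diagram. -/
  blocks : Setoid (Fin m ⊕ Fin n)
  /-- Every string joins two different nodes. -/
  isPerfectMatching : IsPerfectMatching blocks

/-- The set partition of `m + n + k` nodes generated by placing `s` (on the rows of `m` and `n`
nodes) on top of `t` (on the rows of `n` and `k` nodes): its blocks are the connected components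
of the picture obtained by concatenation. -/
def stack {m n k : ℕ} (s : Setoid (Fin m ⊕ Fin n)) (t : Setoid (Fin n ⊕ Fin k)) :
    Setoid (Fin m ⊕ Fin n ⊕ Fin k) :=
  s.map (Sum.map id Sum.inl) ⊔ t.map Sum.inr

theorem upper_injective {α β γ : Type*} :
    (Sum.map id Sum.inl : α ⊕ β → α ⊕ β ⊕ γ).Injective :=
  Function.injective_id.sumMap Sum.inl_injective

theorem outer_injective {α β γ : Type*} :
    (Sum.map id Sum.inr : α ⊕ γ → α ⊕ β ⊕ γ).Injective :=
  Function.injective_id.sumMap Sum.inr_injective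

theorem IsPerfectMatching.exists_perm {X : Type*} {s : Setoid X} (hs : IsPerfectMatching s) :
    ∃ p : Equiv.Perm X, p * p = 1 ∧ (∀ x, p x ≠ x) ∧ ∀ x y, s x y ↔ x = y ∨ p x = y := by
  choose f hf hf' using hs
  have hinv : Function.Involutive f := fun x =>
    (hf' (f x) x ⟨(hf x).1.symm, s.symm' (hf x).2⟩).symm
  refine ⟨hinv.toPerm f, Equiv.ext hinv, fun x => (hf x).1, fun x y => ⟨fun h => ?_, ?_⟩⟩
  · by_cases hxy : x = y
    · exact Or.inl hxy
    · exact Or.inr (hf' x y ⟨fun h => hxy h.symm, h⟩).symm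
  · rintro (rfl | rfl)
    · exact s.refl' _
    · exact (hf x).2

theorem stack_isPerfectMatching {m n k : ℕ} {s : Setoid (Fin m ⊕ Fin n)}
    {t : Setoid (Fin n ⊕ Fin k)} (hs : IsPerfectMatching s) (ht : IsPerfectMatching t) :
    IsPerfectMatching ((stack s t).comap (Sum.map id Sum.inr)) := by
  obtain ⟨p, hp, hpx, hps⟩ := hs.exists_perm
  obtain ⟨q, hq, hqx, hqt⟩ := ht.exists_perm
  let A : Equiv.Perm (Fin m ⊕ Fin n ⊕ Fin k) :=
    (Equiv.sumAssoc _ _ _).permCongr (Equiv.sumCongr p (Equiv.refl (Fin k)))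
  let B : Equiv.Perm (Fin m ⊕ Fin n ⊕ Fin k) := Equiv.sumCongr (Equiv.refl (Fin m)) q
  have hAu : ∀ x, A (Sum.map id Sum.inl x) = Sum.map id Sum.inl (p x) := by
    rintro (x | x)
    · simp only [A, Equiv.permCongr_apply, Sum.map_inl, id, Equiv.sumAssoc_symm_apply_inl,
        Equiv.sumCongr_apply]
      rcases p (Sum.inl x) with y | y <;> simp
    · simp only [A, Equiv.permCongr_apply, Sum.map_inr, Equiv.sumAssoc_symm_apply_inr_inl,
        Equiv.sumCongr_apply, Sum.map_inl]
      rcases p (Sum.inr x) with y | y <;> simp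
  have hAb : ∀ x, A (Sum.inr (Sum.inr x)) = Sum.inr (Sum.inr x) := by
    intro x
    simp [A, Equiv.permCongr_apply]
  have hBt : ∀ x, B (Sum.inl x) = Sum.inl x := fun x => by simp [B]
  have hBl : ∀ x, B (Sum.inr x) = Sum.inr (q x) := fun x => by simp [B]
  have hcase : ∀ x : Fin m ⊕ Fin n ⊕ Fin k,
      (∃ y : Fin m ⊕ Fin n, x = Sum.map id Sum.inl y) ∨ ∃ z : Fin k, x = Sum.inr (Sum.inr z) := by
    rintro (x | x | x)
    · exact Or.inl ⟨Sum.inl x, rfl⟩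
    · exact Or.inl ⟨Sum.inr x, rfl⟩
    · exact Or.inr ⟨x, rfl⟩
  have hAne : ∀ y : Fin m ⊕ Fin n, A (Sum.map id Sum.inl y) ≠ Sum.map id Sum.inl y := by
    intro y h
    rw [hAu] at h
    exact hpx y (upper_injective h)
  have hBne : ∀ y : Fin n ⊕ Fin k, B (Sum.inr y) ≠ Sum.inr y := by
    intro y h
    rw [hBl] at h
    exact hqx y (Sum.inr_injective h)
  have hA : A * A = 1 := by
    ext x
    rcases hcase x with ⟨y, rfl⟩ | ⟨z, rfl⟩
    · rw [Equiv.Perm.mul_apply, hAu, hAu, ← Equiv.Perm.mul_apply, hp]; rfl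
    · rw [Equiv.Perm.mul_apply, hAb, hAb]; rfl
  have hB : B * B = 1 := by
    ext x
    rcases x with x | x
    · rw [Equiv.Perm.mul_apply, hBt, hBt]; rfl
    · rw [Equiv.Perm.mul_apply, hBl, hBl, ← Equiv.Perm.mul_apply, hq]; rfl
  have hAB : ∀ x, A x = x → B x ≠ x := by
    intro x hx
    rcases hcase x with ⟨y, rfl⟩ | ⟨z, rfl⟩
    · exact absurd hx (hAne y)
    · exact hBne _
  have hJ : stack s t = Relation.EqvGen.setoid fun x y => A x = y ∨ B x = y := by
    apply le_antisymm
    · refine sup_le ((map_le_iff _ _ _).2 ?_) ((map_le_iff _ _ _).2 ?_)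
      · intro x y h
        rcases (hps x y).1 h with rfl | rfl
        · exact Setoid.refl' _ _
        · exact Relation.EqvGen.rel _ _ (Or.inl (hAu x))
      · intro x y h
        rcases (hqt x y).1 h with rfl | rfl
        · exact Setoid.refl' _ _
        · exact Relation.EqvGen.rel _ _ (Or.inr (hBl x))
    · refine Setoid.eqvGen_le ?_
      rintro x y (rfl | rfl)
      · rcases hcase x with ⟨y, rfl⟩ | ⟨z, rfl⟩
        · rw [hAu]
          exact (le_sup_left : s.map (Sum.map id Sum.inl) ≤ stack s t)
            (Setoid.le_comap_map ((hps _ _).2 (Or.inr rfl)))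
        · rw [hAb]
      · rcases x with x | x
        · rw [hBt]
        · rw [hBl]
          exact (le_sup_right : t.map Sum.inr ≤ stack s t)
            (Setoid.le_comap_map ((hqt _ _).2 (Or.inr rfl)))
  have hJ' : stack s t = Relation.EqvGen.setoid fun x y => B x = y ∨ A x = y := by
    rw [hJ]; simp only [or_comm]
  have hout : ∀ y : Fin m ⊕ Fin n ⊕ Fin k, (A y = y ∨ B y = y) ↔
      ∃ z : Fin m ⊕ Fin k, Sum.map id Sum.inr z = y := by
    rintro (y | y | y)
    · exact ⟨fun _ => ⟨Sum.inl y, rfl⟩, fun _ => Or.inr (hBt y)⟩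
    · refine ⟨?_, ?_⟩
      · rintro (h | h)
        · exact absurd h (hAne (Sum.inr y))
        · exact absurd h (hBne _)
      · rintro ⟨z | z, h⟩ <;> simp at h
    · exact ⟨fun _ => ⟨Sum.inr y, rfl⟩, fun _ => Or.inl (hAb y)⟩
  intro x
  have main : ∃! y, y ≠ Sum.map id Sum.inr x ∧ (A y = y ∨ B y = y) ∧
      stack s t (Sum.map id Sum.inr x) y := by
    rcases x with x | x
    · exact involution_walk A B hA hB hAB _ hJ (Sum.inl x) (hBt x)
    · have := involution_walk B A hB hA (fun y h h' => hAB y h' h) _ hJ' (Sum.inr (Sum.inr x))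
        (hAb x)
      simp only [or_comm (a := B _ = _)] at this
      exact this
  obtain ⟨y, ⟨h1, h2, h3⟩, hy⟩ := main
  obtain ⟨z, rfl⟩ := (hout y).1 h2
  refine ⟨z, ⟨fun h => h1 (by rw [h]), h3⟩, ?_⟩
  rintro w ⟨hw1, hw2⟩
  exact outer_injective (hy _ ⟨fun h => hw1 (outer_injective h), (hout _).2 ⟨w, rfl⟩, hw2⟩)

namespace Diagram

/-- Two Brauer diagrams are equal as soon as they have the same blocks. -/
theorem ext' {m n : ℕ} {d d' : Diagram m n} (h : ∀ x y, d.blocks x y ↔ d'.1 x y) : d = d' := by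
  obtain ⟨s, hs⟩ := d
  obtain ⟨t, ht⟩ := d'
  obtain rfl : s = t := Setoid.ext h
  rfl

/-- The concatenation of two diagrams, `d₁` on top of `d₂`, after removal of the closed loops. -/
def comp {m n k : ℕ} (d₁ : Diagram m n) (d₂ : Diagram n k) : Diagram m k :=
  ⟨(stack d₁.blocks d₂.blocks).comap (Sum.map id Sum.inr), stack_isPerfectMatching d₁.2 d₂.2⟩

/-- The number of closed loops in the concatenation of two diagrams: the connected components
that lie inside the middle row. -/
noncomputable def loops {m n k : ℕ} (d₁ : Diagram m n) (d₂ : Diagram n k) : ℕ :=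
  classesIn (stack d₁.blocks d₂.blocks) (Set.range fun j : Fin n => Sum.inr (Sum.inl j))

/-- The number of through strings of a diagram: the strings that join the top row to the bottom
row. -/
noncomputable def through {m n : ℕ} (d : Diagram m n) : ℕ :=
  Set.ncard {i : Fin m | ∃ j : Fin n, d.blocks (Sum.inl i) (Sum.inr j)}

/-- The diagram of a permutation `g`: the bottom node `j` is joined to the top node `g j`. -/
def ofPerm {n : ℕ} (g : Equiv.Perm (Fin n)) : Diagram n n :=
  ⟨Setoid.ker (Sum.elim id g), by
    have h : ∀ x y : Fin n ⊕ Fin n, Setoid.ker (Sum.elim id g) x y ↔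
        Sum.elim id g x = Sum.elim id g y := fun x y => Iff.rfl
    rintro (i | j)
    · refine ⟨Sum.inr (g⁻¹ i), ⟨by simp, by simp⟩, ?_⟩
      rintro (i' | j') ⟨h1, h2⟩
      · exact absurd (congrArg Sum.inl ((h _ _).1 h2)).symm h1
      · have := (h _ _).1 h2
        simp only [Sum.elim_inl, Sum.elim_inr, id] at this
        rw [this]; simp
    · refine ⟨Sum.inl (g j), ⟨by simp, by simp⟩, ?_⟩
      rintro (i' | j') ⟨h1, h2⟩
      · have := (h _ _).1 h2
        simp only [Sum.elim_inl, Sum.elim_inr, id] at this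
        rw [this]
      · exact absurd (congrArg Sum.inr (g.injective ((h _ _).1 h2))).symm h1⟩

/-- The reflection of a diagram in a horizontal line. -/
def flip {m n : ℕ} (d : Diagram m n) : Diagram n m :=
  ⟨d.blocks.comap Sum.swap, by
    intro x
    obtain ⟨y, ⟨h1, h2⟩, hy⟩ := d.2 x.swap
    refine ⟨y.swap, ⟨fun h => h1 (by rw [← h, Sum.swap_swap]), ?_⟩, ?_⟩
    · rw [Setoid.comap_rel, Sum.swap_swap]; exact h2
    · rintro z ⟨hz1, hz2⟩
      rw [← hy z.swap ⟨fun h => hz1 (Sum.swap_leftInverse.injective h), hz2⟩, Sum.swap_swap]⟩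

section Assoc

variable {m n k l : ℕ}

/-- Four rows, three diagrams. -/
def stack3 (s : Setoid (Fin m ⊕ Fin n)) (t : Setoid (Fin n ⊕ Fin k))
    (u : Setoid (Fin k ⊕ Fin l)) : Setoid (Fin m ⊕ Fin n ⊕ Fin k ⊕ Fin l) :=
  s.map (Sum.map id Sum.inl) ⊔ t.map (Sum.inr ∘ Sum.map id Sum.inl) ⊔ u.map (Sum.inr ∘ Sum.inr)

theorem injective_123 : (Sum.map id (Sum.map id Sum.inl) :
    Fin m ⊕ Fin n ⊕ Fin k → Fin m ⊕ Fin n ⊕ Fin k ⊕ Fin l).Injective :=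
  Function.injective_id.sumMap (Function.injective_id.sumMap Sum.inl_injective)

theorem injective_124 : (Sum.map id (Sum.map id Sum.inr) :
    Fin m ⊕ Fin n ⊕ Fin l → Fin m ⊕ Fin n ⊕ Fin k ⊕ Fin l).Injective :=
  Function.injective_id.sumMap (Function.injective_id.sumMap Sum.inr_injective)

theorem map_stack_123 (s : Setoid (Fin m ⊕ Fin n)) (t : Setoid (Fin n ⊕ Fin k)) :
    (stack s t).map (Sum.map id (Sum.map id Sum.inl) :
      Fin m ⊕ Fin n ⊕ Fin k → Fin m ⊕ Fin n ⊕ Fin k ⊕ Fin l) =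
    s.map (Sum.map id Sum.inl) ⊔ t.map (Sum.inr ∘ Sum.map id Sum.inl) := by
  rw [stack, map_sup, map_map, map_map]
  congr 2
  · funext x; rcases x with x | x <;> rfl

theorem map_stack_234 (t : Setoid (Fin n ⊕ Fin k)) (u : Setoid (Fin k ⊕ Fin l)) :
    (stack t u).map (Sum.inr : _ → Fin m ⊕ Fin n ⊕ Fin k ⊕ Fin l) =
    t.map (Sum.inr ∘ Sum.map id Sum.inl) ⊔ u.map (Sum.inr ∘ Sum.inr) := by
  rw [stack, map_sup, map_map, map_map]

theorem stack3_comap_134 (s : Setoid (Fin m ⊕ Fin n)) (t : Setoid (Fin n ⊕ Fin k))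
    (u : Setoid (Fin k ⊕ Fin l)) :
    (stack3 s t u).comap (Sum.map id Sum.inr) =
      stack ((stack s t).comap (Sum.map id Sum.inr)) u := by
  have hu : u.map (Sum.inr ∘ Sum.inr : _ → Fin m ⊕ Fin n ⊕ Fin k ⊕ Fin l) =
      (u.map (Sum.inr : _ → Fin m ⊕ Fin k ⊕ Fin l)).map (Sum.map id Sum.inr) := by
    rw [map_map]; rfl
  rw [stack3, comap_sup, hu, Setoid.comap_map_eq _ _ outer_injective, ← map_stack_123]
  · rw [stack]
    congr 1
    ext x y
    rw [Setoid.comap_rel, map_rel injective_123, map_rel upper_injective]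
    rcases x with x | x | x <;> rcases y with y | y | y <;>
      simp [Setoid.comap_rel]
  · intro x y h
    rw [map_rel (Sum.inr_injective.comp Sum.inr_injective)] at h
    rcases h with rfl | ⟨a, b, rfl, rfl, h⟩
    · exact Or.inl rfl
    · exact Or.inr ⟨⟨Sum.inr a, rfl⟩, ⟨Sum.inr b, rfl⟩⟩

theorem stack3_comap_124 (s : Setoid (Fin m ⊕ Fin n)) (t : Setoid (Fin n ⊕ Fin k))
    (u : Setoid (Fin k ⊕ Fin l)) :
    (stack3 s t u).comap (Sum.map id (Sum.map id Sum.inr)) =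
      stack s ((stack t u).comap (Sum.map id Sum.inr)) := by
  have hs : s.map (Sum.map id Sum.inl : _ → Fin m ⊕ Fin n ⊕ Fin k ⊕ Fin l) =
      (s.map (Sum.map id Sum.inl : _ → Fin m ⊕ Fin n ⊕ Fin l)).map
        (Sum.map id (Sum.map id Sum.inr)) := by
    rw [map_map]
    congr 1
    funext x; rcases x with x | x <;> rfl
  rw [stack3, sup_assoc, sup_comm, comap_sup, hs, Setoid.comap_map_eq _ _ injective_124,
    ← map_stack_234, sup_comm]
  · rw [stack]
    congr 1
    ext x y
    rw [Setoid.comap_rel, map_rel Sum.inr_injective, map_rel Sum.inr_injective]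
    rcases x with x | x | x <;> rcases y with y | y | y <;>
      simp [Setoid.comap_rel]
  · intro x y h
    rw [map_rel upper_injective] at h
    rcases h with rfl | ⟨a, b, rfl, rfl, h⟩
    · exact Or.inl rfl
    · refine Or.inr ⟨⟨Sum.map id Sum.inl a, ?_⟩, ⟨Sum.map id Sum.inl b, ?_⟩⟩
      · rcases a with a | a <;> rfl
      · rcases b with b | b <;> rfl

theorem comp_assoc (d₁ : Diagram m n) (d₂ : Diagram n k) (d₃ : Diagram k l) :
    (d₁.comp d₂).comp d₃ = d₁.comp (d₂.comp d₃) := by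
  suffices h : ((d₁.comp d₂).comp d₃).blocks = (d₁.comp (d₂.comp d₃)).blocks from
    ext' fun x y => by rw [h]
  change (stack ((stack d₁.blocks d₂.blocks).comap (Sum.map id Sum.inr)) d₃.blocks).comap (Sum.map id Sum.inr) =
    (stack d₁.blocks ((stack d₂.blocks d₃.blocks).comap (Sum.map id Sum.inr))).comap (Sum.map id Sum.inr)
  rw [← stack3_comap_134, ← stack3_comap_124, ← Setoid.comap_comp, ← Setoid.comap_comp]
  have hf : (Sum.map id Sum.inr ∘ Sum.map id Sum.inr :
      Fin m ⊕ Fin l → Fin m ⊕ Fin n ⊕ Fin k ⊕ Fin l) =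
      Sum.map id (Sum.map id Sum.inr) ∘ Sum.map id Sum.inr := by
    funext x; rcases x with x | x <;> rfl
  rw [hf]
  exact Setoid.comap_comp _ _ _

theorem loops_assoc (d₁ : Diagram m n) (d₂ : Diagram n k) (d₃ : Diagram k l) :
    d₁.loops d₂ + (d₁.comp d₂).loops d₃ = d₂.loops d₃ + d₁.loops (d₂.comp d₃) := by
  have h1 := classesIn_sup (Sum.map id Sum.inr : Fin m ⊕ Fin k ⊕ Fin l → _)
    ((stack d₁.blocks d₂.blocks).map (Sum.map id (Sum.map id Sum.inl)))
    (d₃.blocks.map (Sum.inr ∘ Sum.inr : _ → Fin m ⊕ Fin n ⊕ Fin k ⊕ Fin l)) (by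
      intro x y h
      rw [map_rel (Sum.inr_injective.comp Sum.inr_injective)] at h
      rcases h with rfl | ⟨a, b, rfl, rfl, h⟩
      · exact Or.inl rfl
      · exact Or.inr ⟨⟨Sum.inr a, rfl⟩, ⟨Sum.inr b, rfl⟩⟩)
    (Set.range (Sum.map id (Sum.inr ∘ Sum.inr)))ᶜ (by
      apply Set.compl_subset_compl.2
      rintro _ ⟨x | x, rfl⟩
      · exact ⟨Sum.inl x, rfl⟩
      · exact ⟨Sum.inr (Sum.inr x), rfl⟩)
  have h2 := classesIn_sup (Sum.map id (Sum.map id Sum.inr) : Fin m ⊕ Fin n ⊕ Fin l → _)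
    ((stack d₂.blocks d₃.blocks).map Sum.inr)
    (d₁.blocks.map (Sum.map id Sum.inl : _ → Fin m ⊕ Fin n ⊕ Fin k ⊕ Fin l)) (by
      intro x y h
      rw [map_rel upper_injective] at h
      rcases h with rfl | ⟨a, b, rfl, rfl, h⟩
      · exact Or.inl rfl
      · refine Or.inr ⟨⟨Sum.map id Sum.inl a, ?_⟩, ⟨Sum.map id Sum.inl b, ?_⟩⟩
        · rcases a with a | a <;> rfl
        · rcases b with b | b <;> rfl)
    (Set.range (Sum.map id (Sum.inr ∘ Sum.inr)))ᶜ (by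
      apply Set.compl_subset_compl.2
      rintro _ ⟨x | x, rfl⟩
      · exact ⟨Sum.inl x, rfl⟩
      · exact ⟨Sum.inr (Sum.inr x), rfl⟩)
  have e1 : (Set.range (Sum.map id Sum.inr : Fin m ⊕ Fin k ⊕ Fin l →
      Fin m ⊕ Fin n ⊕ Fin k ⊕ Fin l))ᶜ = Sum.map id (Sum.map id Sum.inl) ''
      (Set.range fun j : Fin n => (Sum.inr (Sum.inl j) : Fin m ⊕ Fin n ⊕ Fin k)) := by
    ext x; rcases x with x | x | x | x <;> simp
  have e2 : (Set.range (Sum.map id (Sum.map id Sum.inr) : Fin m ⊕ Fin n ⊕ Fin l →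
      Fin m ⊕ Fin n ⊕ Fin k ⊕ Fin l))ᶜ = Sum.inr ''
      (Set.range fun j : Fin k => (Sum.inr (Sum.inl j) : Fin n ⊕ Fin k ⊕ Fin l)) := by
    ext x; rcases x with x | x | x | x <;> simp
  have e3 : (Sum.map id Sum.inr : Fin m ⊕ Fin k ⊕ Fin l → Fin m ⊕ Fin n ⊕ Fin k ⊕ Fin l) ⁻¹'
      (Set.range (Sum.map id (Sum.inr ∘ Sum.inr) : Fin m ⊕ Fin l → _))ᶜ =
      Set.range fun j : Fin k => Sum.inr (Sum.inl j) := by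
    ext x; rcases x with x | x | x <;> simp
  have e4 : (Sum.map id (Sum.map id Sum.inr) :
      Fin m ⊕ Fin n ⊕ Fin l → Fin m ⊕ Fin n ⊕ Fin k ⊕ Fin l) ⁻¹'
      (Set.range (Sum.map id (Sum.inr ∘ Sum.inr) : Fin m ⊕ Fin l → _))ᶜ =
      Set.range fun j : Fin n => Sum.inr (Sum.inl j) := by
    ext x; rcases x with x | x | x <;> simp
  have s1 : (stack d₁.blocks d₂.blocks).map (Sum.map id (Sum.map id Sum.inl)) ⊔
      d₃.blocks.map (Sum.inr ∘ Sum.inr) = stack3 d₁.blocks d₂.blocks d₃.blocks := by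
    rw [map_stack_123]; rfl
  have s2 : (stack d₂.blocks d₃.blocks).map Sum.inr ⊔ d₁.blocks.map (Sum.map id Sum.inl) =
      stack3 d₁.blocks d₂.blocks d₃.blocks := by
    rw [map_stack_234, sup_comm, ← sup_assoc]; rfl
  rw [s1, e1, e3, classesIn_map injective_123, stack3_comap_134] at h1
  rw [s2, e2, e4, classesIn_map Sum.inr_injective, stack3_comap_124] at h2
  exact h1.symm.trans h2

end Assoc

section Perm

variable {m n k : ℕ}

theorem stack_ofPerm_left (g : Equiv.Perm (Fin m)) (s : Setoid (Fin m ⊕ Fin n)) :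
    stack (ofPerm g).blocks s = s.comap (Sum.elim (fun i => Sum.inl (g⁻¹ i)) id) := by
  apply le_antisymm
  · refine sup_le ((map_le_iff _ _ _).2 ?_) ((map_le_iff _ _ _).2 ?_)
    · intro x y h
      have h : Sum.elim id g x = Sum.elim id g y := h
      rw [Setoid.comap_rel, Setoid.comap_rel]
      have : ∀ x : Fin m ⊕ Fin m, (Sum.elim (fun i => Sum.inl (g⁻¹ i)) id
          (Sum.map id Sum.inl x : Fin m ⊕ Fin m ⊕ Fin n)) =
          (Sum.inl (g⁻¹ (Sum.elim id g x)) : Fin m ⊕ Fin n) := by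
        rintro (x | x) <;> simp
      rw [this, this, h]
    · intro x y h
      exact h
  · intro x y h
    have h0 : ∀ x, stack (ofPerm g).blocks s x
        (Sum.inr (Sum.elim (fun i => Sum.inl (g⁻¹ i)) id x)) := by
      rintro (x | x)
      · have : (ofPerm g).blocks (Sum.inl x) (Sum.inr (g⁻¹ x)) := by
          change Sum.elim id g _ = Sum.elim id g _
          simp
        exact (le_sup_left : (ofPerm g).blocks.map (Sum.map id Sum.inl) ≤ stack (ofPerm g).blocks s)
          (Setoid.le_comap_map this)
      · exact Setoid.refl' _ _
    refine Setoid.trans' _ (h0 x) (Setoid.trans' _ ?_ (Setoid.symm' _ (h0 y)))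
    exact (le_sup_right : s.map Sum.inr ≤ stack (ofPerm g).blocks s) (Setoid.le_comap_map h)

theorem stack_ofPerm_right (s : Setoid (Fin m ⊕ Fin n)) (g : Equiv.Perm (Fin n)) :
    stack s (ofPerm g).blocks =
      s.comap (Sum.elim Sum.inl (Sum.elim Sum.inr fun j => Sum.inr (g j))) := by
  apply le_antisymm
  · refine sup_le ((map_le_iff _ _ _).2 ?_) ((map_le_iff _ _ _).2 ?_)
    · intro x y h
      rcases x with x | x <;> rcases y with y | y <;> exact h
    · intro x y h
      have h : Sum.elim id g x = Sum.elim id g y := h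
      rw [Setoid.comap_rel, Setoid.comap_rel]
      have : ∀ x : Fin n ⊕ Fin n, (Sum.elim Sum.inl (Sum.elim Sum.inr fun j => Sum.inr (g j))
          (Sum.inr x : Fin m ⊕ Fin n ⊕ Fin n)) =
          (Sum.inr (Sum.elim id g x) : Fin m ⊕ Fin n) := by
        rintro (x | x) <;> simp
      rw [this, this, h]
  · intro x y h
    have h0 : ∀ x, stack s (ofPerm g).blocks x (Sum.map id Sum.inl
        (Sum.elim Sum.inl (Sum.elim Sum.inr fun j => Sum.inr (g j)) x)) := by
      rintro (x | x | x)
      · exact Setoid.refl' _ _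
      · exact Setoid.refl' _ _
      · have : (ofPerm g).blocks (Sum.inr x) (Sum.inl (g x)) := by
          change Sum.elim id g _ = Sum.elim id g _
          simp
        exact (le_sup_right : (ofPerm g).blocks.map Sum.inr ≤ stack s (ofPerm g).blocks)
          (Setoid.le_comap_map this)
    refine Setoid.trans' _ (h0 x) (Setoid.trans' _ ?_ (Setoid.symm' _ (h0 y)))
    exact (le_sup_left : s.map (Sum.map id Sum.inl) ≤ stack s (ofPerm g).blocks)
      (Setoid.le_comap_map h)

theorem ofPerm_comp_rel (g : Equiv.Perm (Fin m)) (d : Diagram m n) (x y : Fin m ⊕ Fin n) :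
    ((ofPerm g).comp d).blocks x y ↔ d.blocks (Sum.map (g⁻¹ : Equiv.Perm (Fin m)) id x)
      (Sum.map (g⁻¹ : Equiv.Perm (Fin m)) id y) := by
  change stack (ofPerm g).blocks d.blocks _ _ ↔ _
  rw [stack_ofPerm_left, Setoid.comap_rel]
  rcases x with x | x <;> rcases y with y | y <;> rfl

theorem comp_ofPerm_rel (d : Diagram m n) (g : Equiv.Perm (Fin n)) (x y : Fin m ⊕ Fin n) :
    (d.comp (ofPerm g)).blocks x y ↔ d.blocks (Sum.map id g x) (Sum.map id g y) := by
  change stack d.blocks (ofPerm g).blocks _ _ ↔ _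
  rw [stack_ofPerm_right, Setoid.comap_rel]
  rcases x with x | x <;> rcases y with y | y <;> rfl

theorem loops_ofPerm_left (g : Equiv.Perm (Fin m)) (d : Diagram m n) :
    (ofPerm g).loops d = 0 := by
  rw [loops, classesIn, stack_ofPerm_left]
  convert Set.ncard_empty (Set (Fin m ⊕ Fin m ⊕ Fin n))
  rw [Set.eq_empty_iff_forall_notMem]
  rintro c ⟨⟨x, rfl⟩, h⟩
  obtain ⟨j, rfl⟩ := h (Set.mem_ofPred_eq.mpr (Setoid.refl' _ x))
  have : Sum.inl (g j) ∈ {x | (d.blocks.comap (Sum.elim (fun i => Sum.inl (g⁻¹ i)) id)) x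
      (Sum.inr (Sum.inl j))} := by
    change d.blocks _ _
    simp
  obtain ⟨i, hi⟩ := h this
  simp at hi

theorem loops_ofPerm_right (d : Diagram m n) (g : Equiv.Perm (Fin n)) :
    d.loops (ofPerm g) = 0 := by
  rw [loops, classesIn, stack_ofPerm_right]
  convert Set.ncard_empty (Set (Fin m ⊕ Fin n ⊕ Fin n))
  rw [Set.eq_empty_iff_forall_notMem]
  rintro c ⟨⟨x, rfl⟩, h⟩
  obtain ⟨j, rfl⟩ := h (Set.mem_ofPred_eq.mpr (Setoid.refl' _ x))
  have : Sum.inr (Sum.inr (g⁻¹ j)) ∈ {x | (d.blocks.comap (Sum.elim Sum.inl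
      (Sum.elim Sum.inr fun j => Sum.inr (g j)))) x (Sum.inr (Sum.inl j))} := by
    change d.blocks _ _
    simp
  obtain ⟨i, hi⟩ := h this
  simp at hi

theorem one_comp (d : Diagram m n) : (ofPerm 1).comp d = d := by
  apply ext'
  intro x y
  rw [ofPerm_comp_rel]
  rcases x with x | x <;> rcases y with y | y <;> simp

theorem comp_one (d : Diagram m n) : d.comp (ofPerm 1) = d := by
  apply ext'
  intro x y
  rw [comp_ofPerm_rel]
  rcases x with x | x <;> rcases y with y | y <;> simp

theorem ofPerm_mul (g h : Equiv.Perm (Fin n)) : ofPerm (g * h) = (ofPerm g).comp (ofPerm h) := by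
  apply ext'
  intro x y
  rw [comp_ofPerm_rel]
  change Sum.elim id _ x = Sum.elim id _ y ↔ Sum.elim id _ _ = Sum.elim id _ _
  rcases x with x | x <;> rcases y with y | y <;> simp

theorem ofPerm_injective : (ofPerm : Equiv.Perm (Fin n) → Diagram n n).Injective := by
  intro g h hgh
  ext j
  have h1 : (ofPerm g).blocks (Sum.inr j) (Sum.inl (g j)) := by
    change Sum.elim id g _ = Sum.elim id g _
    simp
  rw [hgh] at h1
  have h2 : Sum.elim id h (Sum.inr j) = Sum.elim id h (Sum.inl (g j)) := h1
  simp only [Sum.elim_inl, Sum.elim_inr, id] at h2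
  rw [h2]

end Perm

section Through

variable {m n k : ℕ}

theorem eq_of_rel (d : Diagram m n) {x y z : Fin m ⊕ Fin n} (hy : d.blocks x y) (hz : d.blocks x z)
    (hxy : y ≠ x) (hxz : z ≠ x) : y = z :=
  (d.2 x).unique ⟨hxy, hy⟩ ⟨hxz, hz⟩

theorem through_flip (d : Diagram m n) : d.flip.through = d.through := by
  have hex : ∀ i ∈ {i : Fin m | ∃ j : Fin n, d.blocks (Sum.inl i) (Sum.inr j)},
      ∃ j, d.blocks (Sum.inl i) (Sum.inr j) := fun i hi => hi
  refine (Set.ncard_congr (fun i hi => (hex i hi).choose) ?_ ?_ ?_).symm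
  · intro i hi
    exact ⟨i, d.blocks.symm' (hex i hi).choose_spec⟩
  · intro a b ha hb hab
    have h1 := (hex a ha).choose_spec
    have h2 := (hex b hb).choose_spec
    rw [← hab] at h2
    exact Sum.inl_injective (d.eq_of_rel (d.blocks.symm' h1) (d.blocks.symm' h2) (by simp) (by simp))
  · rintro j ⟨i, hi⟩
    have hi : d.blocks (Sum.inr j) (Sum.inl i) := hi
    have hi' : i ∈ {i : Fin m | ∃ j : Fin n, d.blocks (Sum.inl i) (Sum.inr j)} := ⟨j, d.blocks.symm' hi⟩
    exact ⟨i, hi', Sum.inr_injective (d.eq_of_rel (hex i hi').choose_spec (d.blocks.symm' hi)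
      (by simp) (by simp))⟩

theorem through_comp_le_left (d₁ : Diagram m n) (d₂ : Diagram n k) :
    (d₁.comp d₂).through ≤ d₁.through := by
  refine Set.ncard_le_ncard ?_ (Set.toFinite _)
  rintro i ⟨j, hj⟩
  obtain ⟨y, ⟨hy1, hy2⟩, -⟩ := d₁.2 (Sum.inl i)
  rcases y with y | y
  · exfalso
    have h : (d₁.comp d₂).blocks (Sum.inl i) (Sum.inl y) :=
      (le_sup_left : d₁.blocks.map (Sum.map id Sum.inl) ≤ stack d₁.blocks d₂.blocks) (Setoid.le_comap_map hy2)
    have := (d₁.comp d₂).eq_of_rel h hj (fun h => hy1 (by rw [Sum.inl_injective h])) (by simp)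
    simp at this
  · exact ⟨y, hy2⟩

/-- Reversal of the order of three rows. -/
def rev {α β γ : Type*} : α ⊕ β ⊕ γ → γ ⊕ β ⊕ α :=
  Sum.elim (Sum.inr ∘ Sum.inr) (Sum.elim (Sum.inr ∘ Sum.inl) Sum.inl)

theorem rev_rev {α β γ : Type*} (x : α ⊕ β ⊕ γ) : rev (rev x) = x := by
  rcases x with x | x | x <;> rfl

theorem rev_injective {α β γ : Type*} : (rev : α ⊕ β ⊕ γ → γ ⊕ β ⊕ α).Injective :=
  Function.LeftInverse.injective rev_rev

theorem stack_flip (s : Setoid (Fin m ⊕ Fin n)) (t : Setoid (Fin n ⊕ Fin k)) :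
    stack (t.comap Sum.swap) (s.comap Sum.swap) = (stack s t).map rev := by
  have hswap : ∀ {α β : Type} (r : Setoid (α ⊕ β)), r.comap Sum.swap = r.map Sum.swap := by
    intro α β r
    have hinj : (Sum.swap : β ⊕ α → α ⊕ β).Injective := Sum.swap_leftInverse.injective
    rw [← Setoid.comap_map_eq (Sum.swap : β ⊕ α → α ⊕ β) (r.map Sum.swap) hinj, map_map]
    have : (Sum.swap ∘ Sum.swap : α ⊕ β → α ⊕ β) = id := by
      funext x; simp
    rw [this]
    congr 1
    ext x y
    rw [map_rel Function.injective_id]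
    constructor
    · exact fun h => Or.inr ⟨x, y, rfl, rfl, h⟩
    · rintro (rfl | ⟨a, b, rfl, rfl, h⟩)
      · exact r.refl' _
      · exact h
  rw [hswap, hswap, stack, stack, map_sup, map_map, map_map, map_map, map_map, sup_comm]
  have h1 : (Sum.inr ∘ Sum.swap : Fin m ⊕ Fin n → Fin k ⊕ Fin n ⊕ Fin m) =
      rev ∘ Sum.map id Sum.inl := by
    funext x; rcases x with x | x <;> rfl
  have h2 : (Sum.map id Sum.inl ∘ Sum.swap : Fin n ⊕ Fin k → Fin k ⊕ Fin n ⊕ Fin m) =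
      rev ∘ Sum.inr := by
    funext x; rcases x with x | x <;> rfl
  rw [h1, h2]

theorem flip_comp (d₁ : Diagram m n) (d₂ : Diagram n k) :
    (d₁.comp d₂).flip = d₂.flip.comp d₁.flip := by
  apply ext'
  intro x y
  change stack d₁.blocks d₂.blocks _ _ ↔
    stack (d₂.blocks.comap Sum.swap) (d₁.blocks.comap Sum.swap) _ _
  rw [stack_flip, map_rel rev_injective]
  constructor
  · intro h
    refine Or.inr ⟨_, _, ?_, ?_, h⟩
    · rcases x with x | x <;> rfl
    · rcases y with y | y <;> rfl
  · rintro (h | ⟨a, b, h1, h2, h⟩)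
    · rw [outer_injective h]
    · have h1' := congrArg rev h1
      have h2' := congrArg rev h2
      rw [rev_rev] at h1' h2'
      subst h1' h2'
      rcases x with x | x <;> rcases y with y | y <;> exact h

theorem loops_flip (d₁ : Diagram m n) (d₂ : Diagram n k) :
    d₂.flip.loops d₁.flip = d₁.loops d₂ := by
  change classesIn (stack (d₂.blocks.comap Sum.swap) (d₁.blocks.comap Sum.swap)) _ =
    classesIn (stack d₁.blocks d₂.blocks) _
  rw [stack_flip, ← classesIn_map rev_injective (stack d₁.blocks d₂.blocks)]
  congr 1
  ext x; rcases x with x | x | x <;> simp [rev]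

theorem through_comp_le_right (d₁ : Diagram m n) (d₂ : Diagram n k) :
    (d₁.comp d₂).through ≤ d₂.through := by
  rw [← through_flip, flip_comp, ← through_flip d₂]
  exact through_comp_le_left _ _

theorem flip_ofPerm (g : Equiv.Perm (Fin n)) : (ofPerm g).flip = ofPerm g⁻¹ := by
  apply ext'
  intro x y
  change Sum.elim id g _ = Sum.elim id g _ ↔ Sum.elim id _ x = Sum.elim id _ y
  rcases x with x | x <;> rcases y with y | y <;>
    simp [Equiv.eq_symm_apply, Equiv.symm_apply_eq]

theorem through_ofPerm (g : Equiv.Perm (Fin n)) : (ofPerm g).through = n := by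
  rw [through]
  convert Set.ncard_univ (Fin n) using 2
  · ext i
    refine ⟨fun _ => trivial, fun _ => ⟨g⁻¹ i, ?_⟩⟩
    change Sum.elim id g _ = Sum.elim id g _
    simp
  · simp

end Through

end Diagram

/-! ### The Brauer algebra -/

/-- The free `K`-module on the diagrams with `m` top and `n` bottom nodes. The loop parameter `δ`
enters only into the composition of such linear combinations. -/
def BrauerHom (K : Type*) [CommRing K] (_δ : K) (m n : ℕ) : Type _ :=
  Diagram m n →₀ K

namespace BrauerHom

variable {K : Type*} [CommRing K] {δ : K} {m n k l : ℕ}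

noncomputable instance : AddCommGroup (BrauerHom K δ m n) :=
  inferInstanceAs (AddCommGroup (Diagram m n →₀ K))

noncomputable instance : Module K (BrauerHom K δ m n) :=
  inferInstanceAs (Module K (Diagram m n →₀ K))

/-- A diagram as a basis element. -/
noncomputable def ofDiagram (δ : K) (d : Diagram m n) : BrauerHom K δ m n :=
  Finsupp.single d (1 : K)

/-- The coefficient of a diagram. -/
noncomputable def coeff (d : Diagram m n) : BrauerHom K δ m n →ₗ[K] K :=
  Finsupp.lapply d

/-- Linear extension of a map defined on diagrams. -/
noncomputable def extend {M : Type*} [AddCommGroup M] [Module K M] (f : Diagram m n → M) :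
    BrauerHom K δ m n →ₗ[K] M :=
  Finsupp.linearCombination K f

@[simp]
theorem extend_ofDiagram {M : Type*} [AddCommGroup M] [Module K M] (f : Diagram m n → M)
    (d : Diagram m n) : extend f (ofDiagram δ d) = f d := by
  refine (Finsupp.linearCombination_single K 1 d).trans (one_smul K _)

open Classical in
theorem coeff_ofDiagram (d d' : Diagram m n) :
    coeff d (ofDiagram δ d') = if d' = d then 1 else 0 :=
  Finsupp.single_apply

theorem span_ofDiagram : Submodule.span K (Set.range (ofDiagram δ (m := m) (n := n))) = ⊤ := by
  rw [eq_top_iff]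
  rintro x -
  refine Finsupp.induction_linear (motive := fun x : Diagram m n →₀ K =>
    (show BrauerHom K δ m n from x) ∈
      Submodule.span K (Set.range (ofDiagram δ (m := m) (n := n)))) x ?_ ?_ ?_
  · exact Submodule.zero_mem _
  · exact fun f g hf hg => Submodule.add_mem _ hf hg
  · intro d c
    have : (show BrauerHom K δ m n from Finsupp.single d c) = c • ofDiagram δ d := by
      refine (Finsupp.smul_single_one d c).symm
    rw [this]
    exact Submodule.smul_mem _ _ (Submodule.subset_span ⟨d, rfl⟩)

theorem induction {p : BrauerHom K δ m n → Prop} (h0 : p 0) (hd : ∀ d, p (ofDiagram δ d))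
    (hadd : ∀ x y, p x → p y → p (x + y)) (hsmul : ∀ (c : K) x, p x → p (c • x))
    (x : BrauerHom K δ m n) : p x := by
  have hx : x ∈ Submodule.span K (Set.range (ofDiagram δ (m := m) (n := n))) := by
    rw [span_ofDiagram]; trivial
  induction hx using Submodule.span_induction with
  | mem x h => obtain ⟨d, rfl⟩ := h; exact hd d
  | zero => exact h0
  | add x y _ _ hx hy => exact hadd x y hx hy
  | smul c x _ hx => exact hsmul c x hx

/-- Composition: two diagrams are concatenated, and every closed loop is replaced by a
factor `δ`. -/
noncomputable def comp :
    BrauerHom K δ m n →ₗ[K] BrauerHom K δ n k →ₗ[K] BrauerHom K δ m k :=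
  extend fun d₁ => extend fun d₂ => δ ^ d₁.loops d₂ • ofDiagram δ (d₁.comp d₂)

@[simp]
theorem comp_ofDiagram (d₁ : Diagram m n) (d₂ : Diagram n k) :
    comp (ofDiagram δ d₁) (ofDiagram δ d₂) = δ ^ d₁.loops d₂ • ofDiagram δ (d₁.comp d₂) := by
  rw [comp, extend_ofDiagram, extend_ofDiagram]

theorem comp_assoc (x : BrauerHom K δ m n) (y : BrauerHom K δ n k) (z : BrauerHom K δ k l) :
    comp (comp x y) z = comp x (comp y z) := by
  induction x using induction with
  | h0 => simp
  | hadd x x' hx hx' => simp [hx, hx']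
  | hsmul c x hx => simp [hx]
  | hd d₁ =>
    induction y using induction with
    | h0 => simp
    | hadd x x' hx hx' => simp [hx, hx']
    | hsmul c x hx => simp [hx]
    | hd d₂ =>
      induction z using induction with
      | h0 => simp
      | hadd x x' hx hx' => simp only [map_add, hx, hx']
      | hsmul c x hx => simp only [map_smul, hx]
      | hd d₃ =>
        simp only [comp_ofDiagram, map_smul, LinearMap.smul_apply, smul_smul, ← pow_add]
        rw [Diagram.comp_assoc, Diagram.loops_assoc]

theorem ofPerm_one_comp (x : BrauerHom K δ m n) :
    comp (ofDiagram δ (Diagram.ofPerm 1)) x = x := by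
  induction x using induction with
  | h0 => simp
  | hadd x x' hx hx' => simp [hx, hx']
  | hsmul c x hx => simp [hx]
  | hd d => rw [comp_ofDiagram, Diagram.loops_ofPerm_left, Diagram.one_comp, pow_zero, one_smul]

theorem comp_ofPerm_one (x : BrauerHom K δ m n) :
    comp x (ofDiagram δ (Diagram.ofPerm 1)) = x := by
  induction x using induction with
  | h0 => simp
  | hadd x x' hx hx' => simp [hx, hx']
  | hsmul c x hx => simp [hx]
  | hd d => rw [comp_ofDiagram, Diagram.loops_ofPerm_right, Diagram.comp_one, pow_zero, one_smul]

/-- The linear extension of the reflection of diagrams. -/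
noncomputable def flip : BrauerHom K δ m n →ₗ[K] BrauerHom K δ n m :=
  extend fun d => ofDiagram δ d.flip

theorem flip_comp (x : BrauerHom K δ m n) (y : BrauerHom K δ n k) :
    flip (comp x y) = comp (flip y) (flip x) := by
  induction x using induction with
  | h0 => simp
  | hadd x x' hx hx' => simp [hx, hx']
  | hsmul c x hx => simp [hx]
  | hd d₁ =>
    induction y using induction with
    | h0 => simp
    | hadd x x' hx hx' => simp [hx, hx']
    | hsmul c x hx => simp [hx]
    | hd d₂ =>
      simp only [comp_ofDiagram, map_smul, flip, extend_ofDiagram]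
      rw [Diagram.flip_comp, Diagram.loops_flip]

end BrauerHom

/-- The Brauer algebra `B_r(δ)`. -/
def BrauerAlgebra (K : Type*) [CommRing K] (δ : K) (r : ℕ) : Type _ :=
  BrauerHom K δ r r

namespace BrauerAlgebra

variable {K : Type*} [CommRing K] {δ : K} {r n : ℕ}

noncomputable instance : AddCommGroup (BrauerAlgebra K δ r) :=
  inferInstanceAs (AddCommGroup (BrauerHom K δ r r))

noncomputable instance : Module K (BrauerAlgebra K δ r) :=
  inferInstanceAs (Module K (BrauerHom K δ r r))

/-- The product of the Brauer algebra. -/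
noncomputable instance : Mul (BrauerAlgebra K δ r) :=
  ⟨fun x y => BrauerHom.comp (show BrauerHom K δ r r from x) (show BrauerHom K δ r r from y)⟩

/-- The identity diagram. -/
noncomputable instance : One (BrauerAlgebra K δ r) :=
  ⟨BrauerHom.ofDiagram δ (Diagram.ofPerm 1)⟩

theorem mul_def (x y : BrauerAlgebra K δ r) :
    x * y = BrauerHom.comp (show BrauerHom K δ r r from x) (show BrauerHom K δ r r from y) :=
  rfl

noncomputable instance : Ring (BrauerAlgebra K δ r) :=
  { (inferInstance : AddCommGroup (BrauerAlgebra K δ r)),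
    (inferInstance : Mul (BrauerAlgebra K δ r)),
    (inferInstance : One (BrauerAlgebra K δ r)) with
    left_distrib := fun x y z => map_add (BrauerHom.comp (show BrauerHom K δ r r from x)) y z
    right_distrib := fun x y z => LinearMap.map_add₂ BrauerHom.comp x y z
    zero_mul := fun x => LinearMap.map_zero₂ BrauerHom.comp x
    mul_zero := fun x => map_zero (BrauerHom.comp (show BrauerHom K δ r r from x))
    mul_assoc := BrauerHom.comp_assoc
    one_mul := BrauerHom.ofPerm_one_comp
    mul_one := BrauerHom.comp_ofPerm_one }

noncomputable instance : Algebra K (BrauerAlgebra K δ r) :=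
  Algebra.ofModule (fun c x y => LinearMap.map_smul₂ BrauerHom.comp c x y)
    (fun c x y => map_smul (BrauerHom.comp (show BrauerHom K δ r r from x)) c y)

/-- Diagrams with `r` top nodes span left modules over `B_r(δ)`, by concatenation from above. -/
noncomputable instance : Module (BrauerAlgebra K δ r) (BrauerHom K δ r n) where
  smul b x := BrauerHom.comp (show BrauerHom K δ r r from b) x
  one_smul := BrauerHom.ofPerm_one_comp
  mul_smul := BrauerHom.comp_assoc
  smul_zero b := map_zero (BrauerHom.comp (show BrauerHom K δ r r from b))
  smul_add b := map_add (BrauerHom.comp (show BrauerHom K δ r r from b))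
  add_smul b b' x := LinearMap.map_add₂ BrauerHom.comp b b' x
  zero_smul x := LinearMap.map_zero₂ BrauerHom.comp x

theorem smul_def (b : BrauerAlgebra K δ r) (x : BrauerHom K δ r n) :
    b • x = BrauerHom.comp (show BrauerHom K δ r r from b) x :=
  rfl

instance : IsScalarTower K (BrauerAlgebra K δ r) (BrauerHom K δ r n) :=
  ⟨fun c b x => LinearMap.map_smul₂ BrauerHom.comp c b x⟩

/-- A diagram as an element of the Brauer algebra. -/
noncomputable def ofDiagram (δ : K) (d : Diagram r r) : BrauerAlgebra K δ r :=
  BrauerHom.ofDiagram δ d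

theorem induction {p : BrauerAlgebra K δ r → Prop} (h0 : p 0) (hd : ∀ d, p (ofDiagram δ d))
    (hadd : ∀ x y, p x → p y → p (x + y)) (hsmul : ∀ (c : K) x, p x → p (c • x))
    (x : BrauerAlgebra K δ r) : p x :=
  BrauerHom.induction h0 hd hadd hsmul x

theorem ofDiagram_mul (d d' : Diagram r r) :
    ofDiagram δ d * ofDiagram δ d' = δ ^ d.loops d' • ofDiagram δ (d.comp d') :=
  BrauerHom.comp_ofDiagram d d'

theorem ofDiagram_smul (d : Diagram r r) (d' : Diagram r n) :
    ofDiagram δ d • BrauerHom.ofDiagram δ d' =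
      δ ^ d.loops d' • BrauerHom.ofDiagram δ (d.comp d') :=
  BrauerHom.comp_ofDiagram d d'

end BrauerAlgebra

/-- The ideal `B_r^m` of `B_r(δ)` spanned by the diagrams with at most `m` through strings. -/
noncomputable def throughIdeal (K : Type*) [CommRing K] (δ : K) (r m : ℕ) :
    Ideal (BrauerAlgebra K δ r) :=
  { Submodule.span K {x | ∃ d : Diagram r r, d.through ≤ m ∧
      x = BrauerAlgebra.ofDiagram δ d} with
    smul_mem' := by
      intro b x hx
      change x ∈ Submodule.span K _ at hx
      change b * x ∈ Submodule.span K _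
      induction hx using Submodule.span_induction with
      | zero => rw [mul_zero]; exact Submodule.zero_mem _
      | add x y _ _ hx hy => rw [mul_add]; exact Submodule.add_mem _ hx hy
      | smul c x _ hx => rw [mul_smul_comm]; exact Submodule.smul_mem _ _ hx
      | mem x h =>
        obtain ⟨d, hd, rfl⟩ := h
        induction b using BrauerAlgebra.induction with
        | h0 => rw [zero_mul]; exact Submodule.zero_mem _
        | hadd x y hx hy => rw [add_mul]; exact Submodule.add_mem _ hx hy
        | hsmul c x hx => rw [smul_mul_assoc]; exact Submodule.smul_mem _ _ hx
        | hd d' =>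
          rw [BrauerAlgebra.ofDiagram_mul]
          exact Submodule.smul_mem _ _ (Submodule.subset_span
            ⟨_, (Diagram.through_comp_le_right _ _).trans hd, rfl⟩) }

theorem mem_throughIdeal {K : Type*} [CommRing K] {δ : K} {r m : ℕ} {x : BrauerAlgebra K δ r} :
    x ∈ throughIdeal K δ r m ↔ x ∈ Submodule.span K {x | ∃ d : Diagram r r, d.through ≤ m ∧
      x = BrauerAlgebra.ofDiagram δ d} :=
  Iff.rfl

instance {K : Type*} [CommRing K] {δ : K} {r m : ℕ} : (throughIdeal K δ r m).IsTwoSided := by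
  refine ⟨fun {x} b hx => ?_⟩
  rw [mem_throughIdeal] at hx ⊢
  induction hx using Submodule.span_induction with
  | zero => rw [zero_mul]; exact Submodule.zero_mem _
  | add x y _ _ hx hy => rw [add_mul]; exact Submodule.add_mem _ hx hy
  | smul c x _ hx => rw [smul_mul_assoc]; exact Submodule.smul_mem _ _ hx
  | mem x h =>
    obtain ⟨d, hd, rfl⟩ := h
    induction b using BrauerAlgebra.induction with
    | h0 => rw [mul_zero]; exact Submodule.zero_mem _
    | hadd x y hx hy => rw [mul_add]; exact Submodule.add_mem _ hx hy
    | hsmul c x hx => rw [mul_smul_comm]; exact Submodule.smul_mem _ _ hx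
    | hd d' =>
      rw [BrauerAlgebra.ofDiagram_mul]
      exact Submodule.smul_mem _ _ (Submodule.subset_span
        ⟨_, (Diagram.through_comp_le_left _ _).trans hd, rfl⟩)

/-! ### Specht modules -/

/-- The sum of the permutations that preserve every row of the tableau `T`. -/
noncomputable def rowSum (K : Type*) [CommRing K] {t : ℕ} {μ : YoungDiagram}
    (T : Fin t ≃ μ.cells) : MonoidAlgebra K (Equiv.Perm (Fin t)) :=
  open Classical in
  ∑ g : Equiv.Perm (Fin t) with ∀ i, (T (g i)).1.1 = (T i).1.1, MonoidAlgebra.single g 1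

/-- The signed sum of the permutations that preserve every column of the tableau `T`. -/
noncomputable def colSum (K : Type*) [CommRing K] {t : ℕ} {μ : YoungDiagram}
    (T : Fin t ≃ μ.cells) : MonoidAlgebra K (Equiv.Perm (Fin t)) :=
  open Classical in
  ∑ g : Equiv.Perm (Fin t) with ∀ i, (T (g i)).1.2 = (T i).1.2,
    MonoidAlgebra.single g ((Equiv.Perm.sign g : ℤ) : K)

/-- The Specht module `S(μ)`, where `T` is a bijective tableau of shape `μ`: the left ideal
of the group algebra of `Sym_t` generated by the Young symmetrizer of `T`. Right multiplication
by the row sum of `T` identifies the group algebra modulo row permutations with the permutation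
module on the tabloids of shape `μ`, and `S(μ)` with the span of the polytabloids. -/
noncomputable abbrev SpechtModule (K : Type*) [CommRing K] {t : ℕ} {μ : YoungDiagram}
    (T : Fin t ≃ μ.cells) :
    Submodule (MonoidAlgebra K (Equiv.Perm (Fin t))) (MonoidAlgebra K (Equiv.Perm (Fin t))) :=
  Submodule.span _ {colSum K T * rowSum K T}

/-- The symmetric bilinear form on the group algebra for which the group elements are
orthonormal. -/
noncomputable def groupForm (K : Type*) [CommRing K] (G : Type*) [Group G] [Fintype G] :
    MonoidAlgebra K G →ₗ[K] MonoidAlgebra K G →ₗ[K] K :=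
  LinearMap.mk₂ K (fun a b => ∑ g, a.coeff g * b.coeff g)
    (by intro a b c; simp [add_mul, Finset.sum_add_distrib])
    (by intro c a b; simp [mul_assoc, Finset.mul_sum])
    (by intro a b c; simp [mul_add, Finset.sum_add_distrib])
    (by intro c a b; simp [mul_left_comm, Finset.mul_sum])

theorem groupForm_apply {K : Type*} [CommRing K] {G : Type*} [Group G] [Fintype G]
    (a b : MonoidAlgebra K G) : groupForm K G a b = ∑ g, a.coeff g * b.coeff g :=
  rfl

theorem groupForm_single_mul {K : Type*} [CommRing K] {G : Type*} [Group G] [Fintype G]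
    (g : G) (a b : MonoidAlgebra K G) :
    groupForm K G (MonoidAlgebra.single g 1 * a) b =
      groupForm K G a (MonoidAlgebra.single g⁻¹ 1 * b) := by
  rw [groupForm_apply, groupForm_apply]
  refine Fintype.sum_equiv (Equiv.mulLeft g⁻¹) _ _ fun h => ?_
  simp [MonoidAlgebra.coeff_single_mul_apply]

/-! ### Cell modules -/

/-- A bilinear map on `M` that vanishes when one of its arguments is in the submodule `p` induces
a bilinear map on `M ⧸ p`. -/
noncomputable def liftBilin {K B M N : Type*} [CommRing K] [Ring B] [Algebra K B]
    [AddCommGroup M] [Module K M] [Module B M] [IsScalarTower K B M] [AddCommGroup N] [Module K N]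
    (p : Submodule B M) (f : M →ₗ[K] M →ₗ[K] N) (h₁ : ∀ x ∈ p, ∀ y, f x y = 0)
    (h₂ : ∀ x, ∀ y ∈ p, f x y = 0) : (M ⧸ p) →ₗ[K] (M ⧸ p) →ₗ[K] N :=
  let q := (Submodule.Quotient.restrictScalarsEquiv K p).symm.toLinearMap
  let f₁ : M →ₗ[K] (M ⧸ p) →ₗ[K] N :=
    { toFun := fun x => ((p.restrictScalars K).liftQ (f x) fun y hy => h₂ x y hy).comp q
      map_add' := fun x y => LinearMap.ext fun z => by
        obtain ⟨z, rfl⟩ := Submodule.Quotient.mk_surjective p z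
        exact LinearMap.map_add₂ f x y z
      map_smul' := fun c x => LinearMap.ext fun z => by
        obtain ⟨z, rfl⟩ := Submodule.Quotient.mk_surjective p z
        exact LinearMap.map_smul₂ f c x z }
  ((p.restrictScalars K).liftQ f₁ fun x hx => LinearMap.ext fun z => by
    obtain ⟨z, rfl⟩ := Submodule.Quotient.mk_surjective p z
    exact h₁ x hx z).comp q

theorem liftBilin_mk {K B M N : Type*} [CommRing K] [Ring B] [Algebra K B]
    [AddCommGroup M] [Module K M] [Module B M] [IsScalarTower K B M] [AddCommGroup N] [Module K N]
    (p : Submodule B M) (f : M →ₗ[K] M →ₗ[K] N) (h₁ : ∀ x ∈ p, ∀ y, f x y = 0)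
    (h₂ : ∀ x, ∀ y ∈ p, f x y = 0) (x y : M) :
    liftBilin p f h₁ h₂ (Submodule.Quotient.mk x) (Submodule.Quotient.mk y) = f x y :=
  rfl

section CellModule

variable (K : Type*) [CommRing K] (δ : K) (r t : ℕ)

/-- The `B_r(δ)`-submodule spanned by the diagrams with `r` top and `t` bottom nodes that have
fewer than `t` through strings. -/
noncomputable def lowerDiagrams : Submodule (BrauerAlgebra K δ r) (BrauerHom K δ r t) :=
  { Submodule.span K {x | ∃ d : Diagram r t, d.through < t ∧ x = BrauerHom.ofDiagram δ d} with
    smul_mem' := by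
      intro b x hx
      change x ∈ Submodule.span K _ at hx
      change b • x ∈ Submodule.span K _
      induction hx using Submodule.span_induction with
      | zero => rw [smul_zero]; exact Submodule.zero_mem _
      | add x y _ _ hx hy => rw [smul_add]; exact Submodule.add_mem _ hx hy
      | smul c x _ hx => rw [smul_comm]; exact Submodule.smul_mem _ _ hx
      | mem x h =>
        obtain ⟨d, hd, rfl⟩ := h
        induction b using BrauerAlgebra.induction with
        | h0 => rw [zero_smul]; exact Submodule.zero_mem _
        | hadd x y hx hy => rw [add_smul]; exact Submodule.add_mem _ hx hy
        | hsmul c x hx => rw [smul_assoc]; exact Submodule.smul_mem _ _ hx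
        | hd d' =>
          rw [BrauerAlgebra.ofDiagram_smul]
          exact Submodule.smul_mem _ _ (Submodule.subset_span
            ⟨_, (Diagram.through_comp_le_right _ _).trans_lt hd, rfl⟩) }

theorem mem_lowerDiagrams {x : BrauerHom K δ r t} :
    x ∈ lowerDiagrams K δ r t ↔ x ∈ Submodule.span K {x | ∃ d : Diagram r t, d.through < t ∧
      x = BrauerHom.ofDiagram δ d} :=
  Iff.rfl

/-- The `(B_r(δ), K Sym_t)`-bimodule `I_r^t`: linear combinations of diagrams with `r` top and `t`
bottom nodes, modulo the diagrams with fewer than `t` through strings. (If `r = t + 2k`, adding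
`k` arcs on new bottom nodes `t + 1, ..., r` to these diagrams identifies it with the left ideal
`B_r e_{t+1} e_{t+3} ... e_{r-1}` modulo the diagrams with fewer than `t` through strings.) -/
abbrev CellBimodule : Type _ :=
  BrauerHom K δ r t ⧸ lowerDiagrams K δ r t

/-- Right multiplication of diagrams by a permutation of the bottom nodes. -/
noncomputable def BrauerHom.rightMul (g : Equiv.Perm (Fin t)) :
    BrauerHom K δ r t →ₗ[BrauerAlgebra K δ r] BrauerHom K δ r t where
  toFun x := BrauerHom.comp x (BrauerHom.ofDiagram δ (Diagram.ofPerm g))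
  map_add' x y := LinearMap.map_add₂ BrauerHom.comp x y _
  map_smul' b x := BrauerHom.comp_assoc (show BrauerHom K δ r r from b) x _

/-- The right action of `Sym_t` on `I_r^t`. -/
noncomputable def CellBimodule.rightMul (g : Equiv.Perm (Fin t)) :
    CellBimodule K δ r t →ₗ[BrauerAlgebra K δ r] CellBimodule K δ r t :=
  (lowerDiagrams K δ r t).mapQ (lowerDiagrams K δ r t) (BrauerHom.rightMul K δ r t g) (by
    intro x hx
    rw [mem_lowerDiagrams] at hx
    rw [Submodule.mem_comap, mem_lowerDiagrams]
    induction hx using Submodule.span_induction with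
    | zero => rw [map_zero]; exact Submodule.zero_mem _
    | add x y _ _ hx hy => rw [map_add]; exact Submodule.add_mem _ hx hy
    | smul c x _ hx =>
      rw [LinearMap.map_smul_of_tower]; exact Submodule.smul_mem _ _ hx
    | mem x h =>
      obtain ⟨d, hd, rfl⟩ := h
      change BrauerHom.comp _ _ ∈ _
      rw [BrauerHom.comp_ofDiagram]
      exact Submodule.smul_mem _ _ (Submodule.subset_span
        ⟨_, (Diagram.through_comp_le_left _ _).trans_lt hd, rfl⟩))

/-- The linear projection to the group algebra of `Sym_t` that discards all diagrams with fewer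
than `t` through strings, that is, all diagrams that are not permutations. -/
noncomputable def permPart : BrauerHom K δ t t →ₗ[K] MonoidAlgebra K (Equiv.Perm (Fin t)) :=
  ∑ g : Equiv.Perm (Fin t),
    (BrauerHom.coeff (Diagram.ofPerm g)).smulRight (MonoidAlgebra.single g (1 : K))

open Classical in
theorem permPart_ofDiagram (d : Diagram t t) : permPart K δ t (BrauerHom.ofDiagram δ d) =
    ∑ g : Equiv.Perm (Fin t), if d = Diagram.ofPerm g then MonoidAlgebra.single g (1 : K) else 0 := by
  rw [permPart, LinearMap.sum_apply]
  refine Finset.sum_congr rfl fun g _ => ?_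
  rw [LinearMap.smulRight_apply, BrauerHom.coeff_ofDiagram]
  split_ifs <;> simp

theorem permPart_ofPerm (g : Equiv.Perm (Fin t)) :
    permPart K δ t (BrauerHom.ofDiagram δ (Diagram.ofPerm g)) = MonoidAlgebra.single g 1 := by
  classical
  rw [permPart_ofDiagram, Finset.sum_eq_single g]
  · simp
  · intro h _ hne
    rw [if_neg fun h' => hne (Diagram.ofPerm_injective h').symm]
  · simp

theorem permPart_eq_zero {d : Diagram t t} (hd : ∀ g, d ≠ Diagram.ofPerm g) :
    permPart K δ t (BrauerHom.ofDiagram δ d) = 0 := by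
  classical
  rw [permPart_ofDiagram]
  exact Finset.sum_eq_zero fun g _ => if_neg (hd g)

theorem permPart_comp_ofPerm (x : BrauerHom K δ t t) (g : Equiv.Perm (Fin t)) :
    permPart K δ t (BrauerHom.comp x (BrauerHom.ofDiagram δ (Diagram.ofPerm g))) =
      permPart K δ t x * MonoidAlgebra.single g 1 := by
  induction x using BrauerHom.induction with
  | h0 => simp
  | hadd x y hx hy => simp [hx, hy, add_mul]
  | hsmul c x hx => simp [hx]
  | hd d =>
    rw [BrauerHom.comp_ofDiagram, Diagram.loops_ofPerm_right, pow_zero, one_smul]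
    by_cases h : ∃ k, d = Diagram.ofPerm k
    · obtain ⟨k, rfl⟩ := h
      rw [← Diagram.ofPerm_mul, permPart_ofPerm, permPart_ofPerm, MonoidAlgebra.single_mul_single,
        one_mul]
    · push Not at h
      rw [permPart_eq_zero K δ t h, zero_mul, permPart_eq_zero]
      intro k hk
      apply h (k * g⁻¹)
      rw [Diagram.ofPerm_mul, ← hk, Diagram.comp_assoc, ← Diagram.ofPerm_mul, mul_inv_cancel,
        Diagram.comp_one]

theorem permPart_ofPerm_comp (x : BrauerHom K δ t t) (g : Equiv.Perm (Fin t)) :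
    permPart K δ t (BrauerHom.comp (BrauerHom.ofDiagram δ (Diagram.ofPerm g)) x) =
      MonoidAlgebra.single g 1 * permPart K δ t x := by
  induction x using BrauerHom.induction with
  | h0 => simp
  | hadd x y hx hy => simp [hx, hy, mul_add]
  | hsmul c x hx => simp [hx]
  | hd d =>
    rw [BrauerHom.comp_ofDiagram, Diagram.loops_ofPerm_left, pow_zero, one_smul]
    by_cases h : ∃ k, d = Diagram.ofPerm k
    · obtain ⟨k, rfl⟩ := h
      rw [← Diagram.ofPerm_mul, permPart_ofPerm, permPart_ofPerm, MonoidAlgebra.single_mul_single,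
        one_mul]
    · push Not at h
      rw [permPart_eq_zero K δ t h, mul_zero, permPart_eq_zero]
      intro k hk
      apply h (g⁻¹ * k)
      rw [Diagram.ofPerm_mul, ← hk, ← Diagram.comp_assoc, ← Diagram.ofPerm_mul, inv_mul_cancel,
        Diagram.one_comp]

/-- The pairing of `x`, `y` (combinations of diagrams with `r` top and `t` bottom nodes): reflect
`x`, concatenate with `y`, and discard all diagrams with fewer than `t` through strings. -/
noncomputable def diagramPairing : BrauerHom K δ r t →ₗ[K] BrauerHom K δ r t →ₗ[K]
    MonoidAlgebra K (Equiv.Perm (Fin t)) :=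
  ((BrauerHom.comp (δ := δ) (m := t) (n := r) (k := t)).compr₂ (permPart K δ t)).comp
    BrauerHom.flip

theorem diagramPairing_apply (x y : BrauerHom K δ r t) :
    diagramPairing K δ r t x y = permPart K δ t (BrauerHom.comp (BrauerHom.flip x) y) :=
  rfl

theorem diagramPairing_eq_zero {d d' : Diagram r t} (h : d.through < t ∨ d'.through < t) :
    diagramPairing K δ r t (BrauerHom.ofDiagram δ d) (BrauerHom.ofDiagram δ d') = 0 := by
  rw [diagramPairing_apply, BrauerHom.flip, BrauerHom.extend_ofDiagram, BrauerHom.comp_ofDiagram,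
    map_smul, permPart_eq_zero, smul_zero]
  intro g hg
  have h1 := Diagram.through_comp_le_left d.flip d'
  have h2 := Diagram.through_comp_le_right d.flip d'
  rw [hg, Diagram.through_ofPerm] at h1 h2
  rw [Diagram.through_flip] at h1
  omega

/-- The pairing `I_r^t × I_r^t → K Sym_t`. -/
noncomputable def cellPairing : CellBimodule K δ r t →ₗ[K] CellBimodule K δ r t →ₗ[K]
    MonoidAlgebra K (Equiv.Perm (Fin t)) :=
  liftBilin (lowerDiagrams K δ r t) (diagramPairing K δ r t)
    (by
      intro x hx y
      rw [mem_lowerDiagrams] at hx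
      induction hx using Submodule.span_induction with
      | zero => simp
      | add x x' _ _ hx hx' => simp [hx, hx']
      | smul c x _ hx => simp [hx]
      | mem x h =>
        obtain ⟨d, hd, rfl⟩ := h
        induction y using BrauerHom.induction with
        | h0 => simp
        | hadd x y hx hy => simp [hx, hy]
        | hsmul c x hx => simp [hx]
        | hd d' => exact diagramPairing_eq_zero K δ r t (Or.inl hd))
    (by
      intro x y hy
      rw [mem_lowerDiagrams] at hy
      induction hy using Submodule.span_induction with
      | zero => simp
      | add x x' _ _ hx hx' => simp [hx, hx']
      | smul c x _ hx => simp [hx]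
      | mem y h =>
        obtain ⟨d, hd, rfl⟩ := h
        induction x using BrauerHom.induction with
        | h0 => simp
        | hadd x y hx hy => simp [hx, hy]
        | hsmul c x hx => simp [hx]
        | hd d' => exact diagramPairing_eq_zero K δ r t (Or.inr hd))

theorem cellPairing_rightMul_right (x y : CellBimodule K δ r t) (g : Equiv.Perm (Fin t)) :
    cellPairing K δ r t x (CellBimodule.rightMul K δ r t g y) =
      cellPairing K δ r t x y * MonoidAlgebra.single g 1 := by
  obtain ⟨x, rfl⟩ := Submodule.Quotient.mk_surjective _ x
  obtain ⟨y, rfl⟩ := Submodule.Quotient.mk_surjective _ y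
  change diagramPairing K δ r t x (BrauerHom.comp y _) = diagramPairing K δ r t x y * _
  rw [diagramPairing_apply, diagramPairing_apply, ← BrauerHom.comp_assoc, permPart_comp_ofPerm]

theorem cellPairing_rightMul_left (x y : CellBimodule K δ r t) (g : Equiv.Perm (Fin t)) :
    cellPairing K δ r t (CellBimodule.rightMul K δ r t g x) y =
      MonoidAlgebra.single g⁻¹ 1 * cellPairing K δ r t x y := by
  obtain ⟨x, rfl⟩ := Submodule.Quotient.mk_surjective _ x
  obtain ⟨y, rfl⟩ := Submodule.Quotient.mk_surjective _ y
  change diagramPairing K δ r t (BrauerHom.comp x _) y = _ * diagramPairing K δ r t x y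
  rw [diagramPairing_apply, diagramPairing_apply, BrauerHom.flip_comp, BrauerHom.comp_assoc]
  have : BrauerHom.flip (BrauerHom.ofDiagram δ (Diagram.ofPerm g)) =
      BrauerHom.ofDiagram δ (Diagram.ofPerm g⁻¹) := by
    rw [BrauerHom.flip, BrauerHom.extend_ofDiagram, Diagram.flip_ofPerm]
  rw [this, permPart_ofPerm_comp]

variable {t} {μ : YoungDiagram} (T : Fin t ≃ μ.cells)

open scoped TensorProduct

/-- The submodule by which the tensor product over `K` has to be divided to obtain the tensor
product over the group algebra of `Sym_t`. -/
noncomputable def balancingRelations :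
    Submodule (BrauerAlgebra K δ r) (CellBimodule K δ r t ⊗[K] SpechtModule K T) :=
  Submodule.span _ {z | ∃ (x : CellBimodule K δ r t) (g : Equiv.Perm (Fin t))
    (v : SpechtModule K T), z = CellBimodule.rightMul K δ r t g x ⊗ₜ[K] v -
      x ⊗ₜ[K] ((MonoidAlgebra.single g 1 : MonoidAlgebra K (Equiv.Perm (Fin t))) • v)}

/-- The cell module `W_r(μ)`, the tensor product of `I_r^t` and `S(μ)` over the group algebra of
`Sym_t`, as a left module over `B_r(δ)`. -/
abbrev CellModule : Type _ :=
  (CellBimodule K δ r t ⊗[K] SpechtModule K T) ⧸ balancingRelations K δ r T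

/-- The bilinear form with `(x ⊗ u, y ⊗ v) = (u, ⟨x, y⟩ v)`, before passage to the quotient. -/
noncomputable def preForm : (CellBimodule K δ r t ⊗[K] SpechtModule K T) →ₗ[K]
    (CellBimodule K δ r t ⊗[K] SpechtModule K T) →ₗ[K] K :=
  TensorProduct.lift (LinearMap.mk₂ K (fun x u => TensorProduct.lift (LinearMap.mk₂ K
      (fun y v => groupForm K (Equiv.Perm (Fin t)) u.1 (cellPairing K δ r t x y * v.1))
      (by intros; simp [add_mul]) (by intros; simp) (by intros; simp [mul_add])
      (by intros; simp)))
    (by intros; refine TensorProduct.ext' fun y v => ?_; simp [add_mul])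
    (by intros; refine TensorProduct.ext' fun y v => ?_; simp)
    (by intros; refine TensorProduct.ext' fun y v => ?_; simp)
    (by intros; refine TensorProduct.ext' fun y v => ?_; simp))

theorem preForm_tmul (x y : CellBimodule K δ r t) (u v : SpechtModule K T) :
    preForm K δ r T (x ⊗ₜ u) (y ⊗ₜ v) =
      groupForm K (Equiv.Perm (Fin t)) u.1 (cellPairing K δ r t x y * v.1) :=
  rfl

theorem balancingRelations_induction {p : CellBimodule K δ r t ⊗[K] SpechtModule K T → Prop}
    (h0 : p 0) (hadd : ∀ x y, p x → p y → p (x + y))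
    (h : ∀ x g v, p (CellBimodule.rightMul K δ r t g x ⊗ₜ[K] v -
      x ⊗ₜ[K] ((MonoidAlgebra.single g 1 : MonoidAlgebra K (Equiv.Perm (Fin t))) • v)))
    {z : CellBimodule K δ r t ⊗[K] SpechtModule K T} (hz : z ∈ balancingRelations K δ r T) :
    p z := by
  induction hz using Submodule.closure_induction with
  | zero => exact h0
  | add x y _ _ hx hy => exact hadd x y hx hy
  | smul_mem b z hz =>
    obtain ⟨x, g, v, rfl⟩ := hz
    rw [smul_sub, TensorProduct.smul_tmul', TensorProduct.smul_tmul', ← map_smul]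
    exact h _ _ _

/-- The canonical bilinear form of the cell module `W_r(μ)`. -/
noncomputable def cellForm : CellModule K δ r T →ₗ[K] CellModule K δ r T →ₗ[K] K :=
  liftBilin (balancingRelations K δ r T) (preForm K δ r T)
    (by
      intro z hz w
      refine balancingRelations_induction K δ r T (p := fun z => preForm K δ r T z w = 0)
        (by simp) (fun x y hx hy => by simp [hx, hy]) (fun x g u => ?_) hz
      induction w using TensorProduct.induction_on with
      | zero => simp
      | add x y hx hy => simp only [map_add, hx, hy, add_zero]
      | tmul y v =>
        rw [map_sub, LinearMap.sub_apply, preForm_tmul, preForm_tmul, cellPairing_rightMul_left,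
          sub_eq_zero, mul_assoc, ← groupForm_single_mul]
        rfl)
    (by
      intro w z hz
      refine balancingRelations_induction K δ r T (p := fun z => preForm K δ r T w z = 0)
        (by simp) (fun x y hx hy => by simp [hx, hy]) (fun y g v => ?_) hz
      induction w using TensorProduct.induction_on with
      | zero => simp
      | add x y hx hy => simp only [map_add, LinearMap.add_apply, hx, hy, add_zero]
      | tmul x u =>
        rw [map_sub, preForm_tmul, preForm_tmul, cellPairing_rightMul_right, sub_eq_zero,
          mul_assoc]
        rfl)

theorem cellForm_mk_tmul (x y : CellBimodule K δ r t) (u v : SpechtModule K T) :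
    cellForm K δ r T (Submodule.Quotient.mk (x ⊗ₜ u)) (Submodule.Quotient.mk (y ⊗ₜ v)) =
      groupForm K (Equiv.Perm (Fin t)) u.1 (cellPairing K δ r t x y * v.1) :=
  rfl

/-- The radical `Rad_r(μ)` of the canonical bilinear form of the cell module `W_r(μ)`. -/
noncomputable def cellRadical : Submodule K (CellModule K δ r T) :=
  LinearMap.ker (cellForm K δ r T)

theorem mem_cellRadical {w : CellModule K δ r T} :
    w ∈ cellRadical K δ r T ↔ ∀ v, cellForm K δ r T w v = 0 := by
  rw [cellRadical, LinearMap.mem_ker, LinearMap.ext_iff]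
  rfl

end CellModule

end BrauerCell

/-!
For diagrams `x`, `y` with `r` top and `t` bottom nodes, the element `x y*` of the Brauer algebra
and the canonical form of the cell module see a vector `w` through the same element `s` of the
Specht module: `(x y*) w = x ⊗ s`, and `(y ⊗ u, w) = (u, s)` for all `u`
(`exists_preForm_eq_and_comp_smul_eq`).

Let `w` lie in the radical. Then `s` is orthogonal to the Specht module, on which the form is
nondegenerate (`spechtModule_eq_zero`), so that `s = 0` and `x y*` annihilates `w`. A diagram with
exactly `t` through strings is such a product, up to a power of `δ`: cut its through strings
(`Diagram.exists_eq_comp_flip`). Diagrams with fewer through strings annihilate the whole cell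
module.

Conversely, let the ideal annihilate `w`, and let `y` have `t` through strings. Then
`y ⊗ s = (y y*) w = 0`. Since `y* y` is a power of `δ` times the identity diagram
(`Diagram.flip_comp_self`), pairing with `y ⊗ u` turns this into `(u, s) = 0` after division by
that power, that is, `(y ⊗ u, w) = 0`. Such vectors `y ⊗ u` span the cell module.
-/

/-! ### Cutting diagrams along their through strings -/

namespace BrauerCell

namespace Diagram

variable {m n t : ℕ}

theorem eq_of_blocks_le {d d' : Diagram m n} (h : ∀ x y, d.blocks x y → d'.blocks x y) :
    d = d' := by
  refine ext' fun x y => ⟨h x y, fun hxy => ?_⟩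
  obtain ⟨z, ⟨hz, hxz⟩, -⟩ := d.2 x
  by_cases hyx : y = x
  · exact hyx ▸ d.blocks.refl' _
  · exact d'.eq_of_rel (h _ _ hxz) hxy hz hyx ▸ hxz

theorem exists_rel_of_through_eq {d : Diagram m t} (h : d.through = t) (j : Fin t) :
    ∃ i, d.blocks (Sum.inl i) (Sum.inr j) := by
  have huniv : {j : Fin t | ∃ i : Fin m, d.flip.blocks (Sum.inl j) (Sum.inr i)} = Set.univ := by
    rw [Set.eq_univ_iff_ncard, Nat.card_fin]
    exact (through_flip d).trans h
  have hj : j ∈ {j : Fin t | ∃ i : Fin m, d.flip.blocks (Sum.inl j) (Sum.inr i)} :=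
    huniv ▸ Set.mem_univ j
  obtain ⟨i, hi⟩ := hj
  exact ⟨i, d.blocks.symm' hi⟩

theorem flip_flip (d : Diagram m n) : d.flip.flip = d := by
  refine ext' fun x y => ?_
  change d.blocks _ _ ↔ d.blocks x y
  rw [Sum.swap_swap, Sum.swap_swap]

theorem through_le (d : Diagram m t) : d.through ≤ t := by
  rw [← through_flip, through]
  exact (Set.ncard_le_card _).trans_eq (Nat.card_fin t)

theorem stack_left {k : ℕ} {d₁ : Diagram m n} {d₂ : Diagram n k} {x y : Fin m ⊕ Fin n}
    (h : d₁.blocks x y) :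
    stack d₁.blocks d₂.blocks (Sum.map id Sum.inl x) (Sum.map id Sum.inl y) :=
  (le_sup_left : d₁.blocks.map (Sum.map id Sum.inl) ≤ stack d₁.blocks d₂.blocks)
    (Setoid.le_comap_map h)

theorem stack_right {k : ℕ} {d₁ : Diagram m n} {d₂ : Diagram n k} {x y : Fin n ⊕ Fin k}
    (h : d₂.blocks x y) : stack d₁.blocks d₂.blocks (Sum.inr x) (Sum.inr y) :=
  (le_sup_right : d₂.blocks.map Sum.inr ≤ stack d₁.blocks d₂.blocks) (Setoid.le_comap_map h)

theorem comp_rel_of_rel_of_rel {k : ℕ} {d₁ : Diagram m n} {d₂ : Diagram n k} {i : Fin m}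
    {j : Fin n} {l : Fin k} (h₁ : d₁.blocks (Sum.inl i) (Sum.inr j))
    (h₂ : d₂.blocks (Sum.inl j) (Sum.inr l)) :
    (d₁.comp d₂).blocks (Sum.inl i) (Sum.inr l) :=
  Setoid.trans' (stack d₁.blocks d₂.blocks) (stack_left h₁) (stack_right h₂)

theorem eq_ofPerm_of_rel {d : Diagram t t} (g : Equiv.Perm (Fin t))
    (h : ∀ j, d.blocks (Sum.inl (g j)) (Sum.inr j)) : d = ofPerm g := by
  refine (eq_of_blocks_le fun x y hxy => ?_).symm
  replace hxy : Sum.elim id g x = Sum.elim id g y := hxy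
  have hx : ∀ x, d.blocks (Sum.inl (Sum.elim id g x)) x := by
    rintro (i | j)
    · exact d.blocks.refl' _
    · exact h j
  exact d.blocks.trans' (d.blocks.symm' (hx x)) (hxy ▸ hx y)

theorem exists_eq_ofPerm_of_through_eq {d : Diagram t t} (h : d.through = t) :
    ∃ g, d = ofPerm g := by
  choose g hg using exists_rel_of_through_eq h
  have hinj : g.Injective := fun a b hab =>
    Sum.inr_injective (d.eq_of_rel (hg a) (hab ▸ hg b) (by simp) (by simp))
  exact ⟨Equiv.ofBijective g hinj.bijective_of_finite, eq_ofPerm_of_rel _ hg⟩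

/-- All `t` bottom nodes of `y` are ends of through strings, so the picture of `y*` on top of `y`
joins every node to its mirror image. -/
theorem flip_comp_self {y : Diagram m t} (h : y.through = t) : y.flip.comp y = ofPerm 1 := by
  refine eq_ofPerm_of_rel 1 fun j => ?_
  obtain ⟨i, hi⟩ := exists_rel_of_through_eq h j
  exact comp_rel_of_rel_of_rel (y.blocks.symm' hi) hi

theorem _root_.BrauerCell.IsPerfectMatching.comap {X Y : Type*} {s : Setoid X}
    (hs : IsPerfectMatching s) {f : Y → X} (hf : f.Injective)
    (h : ∀ a x, s (f a) x → x ∈ Set.range f) : IsPerfectMatching (s.comap f) := by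
  intro a
  obtain ⟨x, ⟨hx, hax⟩, hx'⟩ := hs (f a)
  obtain ⟨b, rfl⟩ := h a x hax
  exact ⟨b, ⟨fun hb => hx (hb ▸ rfl), hax⟩, fun c hc => hf (hx' _ ⟨fun h => hc.1 (hf h), hc.2⟩)⟩

/-- A diagram with `t` through strings can be cut along a row of `t` nodes placed on its through
strings. -/
theorem exists_eq_comp_flip {b : Diagram m n} (h : b.through = t) :
    ∃ (x : Diagram m t) (y : Diagram n t), b = x.comp y.flip := by
  let e : Fin t ≃ {i : Fin m | ∃ j : Fin n, b.blocks (Sum.inl i) (Sum.inr j)} :=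
    (Finite.equivFinOfCardEq h).symm
  choose p hp using fun k => (e k).2
  have hpinj : p.Injective := fun k l hkl => e.injective <| Subtype.ext <| Sum.inl_injective <|
    b.eq_of_rel (b.blocks.symm' (hp k)) (hkl ▸ b.blocks.symm' (hp l)) (by simp) (by simp)
  have hpe : ∀ i j, b.blocks (Sum.inl i) (Sum.inr j) → ∃ k, (e k).1 = i ∧ p k = j := by
    intro i j hij
    obtain ⟨k, hk⟩ := e.surjective ⟨i, j, hij⟩
    have hk' : (e k).1 = i := congrArg Subtype.val hk
    exact ⟨k, hk', Sum.inr_injective (b.eq_of_rel (hp k) (hk' ▸ hij) (by simp) (by simp))⟩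
  -- The nodes of the cut are identified with the lower ends of the through strings for the upper
  -- half, and with their upper ends for the lower half.
  let x : Diagram m t := ⟨b.blocks.comap (Sum.elim Sum.inl fun k => Sum.inr (p k)),
    b.2.comap (Sum.inl_injective.sumElim (Sum.inr_injective.comp hpinj) (by simp)) (by
      rintro (i | k) (i' | j) hij
      · exact ⟨Sum.inl i', rfl⟩
      · obtain ⟨k, -, rfl⟩ := hpe _ _ hij
        exact ⟨Sum.inr k, rfl⟩
      · exact ⟨Sum.inl i', rfl⟩
      · by_contra hj
        have hne : (Sum.inr j : Fin m ⊕ Fin n) ≠ Sum.inr (p k) := by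
          intro hjk
          exact hj ⟨Sum.inr k, hjk.symm⟩
        exact absurd (b.eq_of_rel hij (b.blocks.symm' (hp k)) hne (by simp)) (by simp))⟩
  let y : Diagram n t := ⟨b.blocks.comap (Sum.elim Sum.inr fun k => Sum.inl (e k).1),
    b.2.comap (Sum.inr_injective.sumElim
      (Sum.inl_injective.comp (Subtype.val_injective.comp e.injective)) (by simp)) (by
      rintro (j | k) (i | j') hij
      · obtain ⟨k, rfl, -⟩ := hpe _ _ (b.blocks.symm' hij)
        exact ⟨Sum.inr k, rfl⟩
      · exact ⟨Sum.inl j', rfl⟩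
      · by_contra hi
        have hne : (Sum.inl i : Fin m ⊕ Fin n) ≠ Sum.inl (e k).1 := by
          intro hik
          exact hi ⟨Sum.inr k, hik.symm⟩
        exact absurd (b.eq_of_rel hij (hp k) hne (by simp)) (by simp)
      · exact ⟨Sum.inl j', rfl⟩)⟩
  have hthrough : ∀ i j, b.blocks (Sum.inl i) (Sum.inr j) →
      (x.comp y.flip).blocks (Sum.inl i) (Sum.inr j) := by
    intro i j hij
    obtain ⟨k, rfl, rfl⟩ := hpe i j hij
    exact comp_rel_of_rel_of_rel (d₁ := x) (d₂ := y.flip) (j := k) hij hij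
  refine ⟨x, y, eq_of_blocks_le ?_⟩
  rintro (i | j) (i' | j') hij
  · exact stack_left (d₁ := x) (d₂ := y.flip) (x := Sum.inl i) (y := Sum.inl i') hij
  · exact hthrough i j' hij
  · exact Setoid.symm' _ (hthrough i' j (b.blocks.symm' hij))
  · exact stack_right (d₁ := x) (d₂ := y.flip) (x := Sum.inr j) (y := Sum.inr j') hij

end Diagram

/-! ### Nondegeneracy on Specht modules -/

section GroupForm

variable {K : Type*} [CommRing K] {G : Type*} [Group G]

/-- Applying a `ℚ`-linear functional to all coefficients commutes with right multiplication by an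
element of the rational group algebra. -/
theorem map_mul_mapRingHom [Algebra ℚ K] (f : K →ₗ[ℚ] ℚ) (a : MonoidAlgebra K G)
    (c : MonoidAlgebra ℚ G) :
    MonoidAlgebra.map f.toAddMonoidHom (a * MonoidAlgebra.mapRingHom G (algebraMap ℚ K) c) =
      MonoidAlgebra.map f.toAddMonoidHom a * c := by
  induction a using MonoidAlgebra.induction_linear with
  | zero => simp
  | add a b ha hb => rw [add_mul, MonoidAlgebra.map_add, ha, hb, MonoidAlgebra.map_add, add_mul]
  | single g k =>
    induction c using MonoidAlgebra.induction_linear with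
    | zero => simp
    | add a b ha hb => rw [map_add, mul_add, MonoidAlgebra.map_add, ha, hb, mul_add]
    | single h q =>
      have : f (k * algebraMap ℚ K q) = f k * q := by
        rw [mul_comm, ← Algebra.smul_def, map_smul, smul_eq_mul, mul_comm]
      simp [MonoidAlgebra.single_mul_single, this]

variable [Fintype G]

theorem groupForm_comm (a b : MonoidAlgebra K G) : groupForm K G a b = groupForm K G b a := by
  simp only [groupForm_apply, mul_comm]

/-- Positivity of the form over `ℚ`. -/
theorem groupForm_self_eq_zero {a : MonoidAlgebra ℚ G} (h : groupForm ℚ G a a = 0) : a = 0 := by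
  rw [groupForm_apply, Finset.sum_eq_zero_iff_of_nonneg fun g _ => mul_self_nonneg _] at h
  ext g
  simpa using h g (Finset.mem_univ g)

theorem groupForm_map [Algebra ℚ K] (f : K →ₗ[ℚ] ℚ) (a : MonoidAlgebra K G)
    (c : MonoidAlgebra ℚ G) :
    groupForm ℚ G (MonoidAlgebra.map f.toAddMonoidHom a) c =
      f (groupForm K G a (MonoidAlgebra.mapRingHom G (algebraMap ℚ K) c)) := by
  rw [groupForm_apply, groupForm_apply, map_sum]
  refine Finset.sum_congr rfl fun g _ => ?_
  rw [MonoidAlgebra.coeff_mapRingHom, mul_comm (a.coeff g), ← Algebra.smul_def, map_smul,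
    smul_eq_mul, mul_comm]
  rfl

/-- The form is nondegenerate on every left ideal of the group algebra that is generated by an
element with rational coefficients. Rational functionals applied to the coefficients reduce this
to the positivity of the form over `ℚ`. -/
theorem mul_mapRingHom_eq_zero [Algebra ℚ K] (c : MonoidAlgebra ℚ G) (a : MonoidAlgebra K G)
    (h : ∀ b : MonoidAlgebra K G,
      groupForm K G (b * MonoidAlgebra.mapRingHom G (algebraMap ℚ K) c)
        (a * MonoidAlgebra.mapRingHom G (algebraMap ℚ K) c) = 0) :
    a * MonoidAlgebra.mapRingHom G (algebraMap ℚ K) c = 0 := by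
  have key : ∀ f : K →ₗ[ℚ] ℚ, MonoidAlgebra.map f.toAddMonoidHom
      (a * MonoidAlgebra.mapRingHom G (algebraMap ℚ K) c) = 0 := by
    intro f
    apply groupForm_self_eq_zero
    nth_rewrite 2 [map_mul_mapRingHom]
    rw [groupForm_map, RingHom.map_mul, groupForm_comm, h, map_zero]
  ext g
  refine (Module.forall_dual_apply_eq_zero_iff ℚ _).1 fun f => ?_
  exact congrArg (fun x => x.coeff g) (key f)

end GroupForm

section Specht

variable {K : Type*} {t : ℕ} {μ : YoungDiagram}

theorem mapRingHom_youngSymmetrizer [CommRing K] [Algebra ℚ K] (T : Fin t ≃ μ.cells) :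
    MonoidAlgebra.mapRingHom _ (algebraMap ℚ K) (colSum ℚ T * rowSum ℚ T) =
      colSum K T * rowSum K T := by
  simp [colSum, rowSum, map_sum]

theorem spechtModule_eq_zero [Field K] [CharZero K] {T : Fin t ≃ μ.cells} {s : SpechtModule K T}
    (h : ∀ u : SpechtModule K T, groupForm K (Equiv.Perm (Fin t)) u.1 s.1 = 0) : s = 0 := by
  obtain ⟨a, ha⟩ := Submodule.mem_span_singleton.1 s.2
  rw [smul_eq_mul, ← mapRingHom_youngSymmetrizer] at ha
  apply Subtype.ext
  rw [← ha]
  refine mul_mapRingHom_eq_zero _ _ fun b => ?_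
  rw [ha, mapRingHom_youngSymmetrizer]
  exact h ⟨_, Submodule.mem_span_singleton.2 ⟨b, rfl⟩⟩

end Specht

/-! ### The action on the cell module and its form -/

section CellModule

variable {K : Type*} [CommRing K] {δ : K} {r t : ℕ}

/-- Reflection of diagrams is adjoint to the form. -/
theorem groupForm_permPart_mul (x : BrauerHom K δ t t)
    (u v : MonoidAlgebra K (Equiv.Perm (Fin t))) :
    groupForm K (Equiv.Perm (Fin t)) (permPart K δ t x * u) v =
      groupForm K (Equiv.Perm (Fin t)) u (permPart K δ t (BrauerHom.flip x) * v) := by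
  induction x using BrauerHom.induction with
  | h0 => simp
  | hadd x y hx hy => simp [add_mul, hx, hy]
  | hsmul c x hx => simp [hx]
  | hd d =>
    rw [BrauerHom.flip, BrauerHom.extend_ofDiagram]
    by_cases h : ∃ g, d = Diagram.ofPerm g
    · obtain ⟨g, rfl⟩ := h
      rw [Diagram.flip_ofPerm, permPart_ofPerm, permPart_ofPerm, groupForm_single_mul]
    · push Not at h
      rw [permPart_eq_zero K δ t h, permPart_eq_zero K δ t (d := d.flip)]
      · simp
      · intro g hg
        refine h g⁻¹ ?_
        rw [← Diagram.flip_ofPerm, ← hg]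
        exact d.flip_flip.symm

theorem BrauerHom.flip_flip (x : BrauerHom K δ r t) : BrauerHom.flip (BrauerHom.flip x) = x := by
  induction x using BrauerHom.induction with
  | h0 => simp
  | hadd x y hx hy => simp [hx, hy]
  | hsmul c x hx => simp [hx]
  | hd d =>
    simp only [BrauerHom.flip, BrauerHom.extend_ofDiagram]
    rw [Diagram.flip_flip]

theorem groupForm_cellPairing_mul (x y : CellBimodule K δ r t)
    (u v : MonoidAlgebra K (Equiv.Perm (Fin t))) :
    groupForm K (Equiv.Perm (Fin t)) (cellPairing K δ r t x y * u) v =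
      groupForm K (Equiv.Perm (Fin t)) u (cellPairing K δ r t y x * v) := by
  obtain ⟨x, rfl⟩ := Submodule.Quotient.mk_surjective _ x
  obtain ⟨y, rfl⟩ := Submodule.Quotient.mk_surjective _ y
  change groupForm K _ (diagramPairing K δ r t x y * u) v =
    groupForm K _ u (diagramPairing K δ r t y x * v)
  rw [diagramPairing_apply, diagramPairing_apply, groupForm_permPart_mul, BrauerHom.flip_comp,
    BrauerHom.flip_flip]

variable {μ : YoungDiagram} {T : Fin t ≃ μ.cells}

open scoped TensorProduct

theorem preForm_comm (z w : CellBimodule K δ r t ⊗[K] SpechtModule K T) :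
    preForm K δ r T z w = preForm K δ r T w z := by
  induction z using TensorProduct.induction_on with
  | zero => simp
  | add z z' hz hz' => simp [hz, hz']
  | tmul x u =>
    induction w using TensorProduct.induction_on with
    | zero => simp
    | add w w' hw hw' => simp [hw, hw']
    | tmul y v =>
      rw [preForm_tmul, preForm_tmul, groupForm_comm, groupForm_cellPairing_mul]

theorem mk_eq_zero_of_through_lt {d : Diagram r t} (h : d.through < t) :
    (Submodule.Quotient.mk (BrauerHom.ofDiagram δ d) : CellBimodule K δ r t) = 0 := by
  rw [Submodule.Quotient.mk_eq_zero, mem_lowerDiagrams]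
  exact Submodule.subset_span ⟨d, h, rfl⟩

/-- Modulo diagrams with fewer than `t` through strings, only the permutations among the diagrams
with `t` top and `t` bottom nodes act on the right, and they can be moved across the tensor sign. -/
theorem mk_comp_tmul (x : Diagram r t) (k : BrauerHom K δ t t) (v : SpechtModule K T) :
    (Submodule.Quotient.mk ((Submodule.Quotient.mk (BrauerHom.comp (BrauerHom.ofDiagram δ x) k) :
      CellBimodule K δ r t) ⊗ₜ[K] v) : CellModule K δ r T) =
    Submodule.Quotient.mk ((Submodule.Quotient.mk (BrauerHom.ofDiagram δ x) :
      CellBimodule K δ r t) ⊗ₜ[K] (permPart K δ t k • v)) := by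
  induction k using BrauerHom.induction with
  | h0 => simp
  | hadd k l hk hl =>
    simp only [map_add, Submodule.Quotient.mk_add, TensorProduct.add_tmul, add_smul,
      TensorProduct.tmul_add, hk, hl]
  | hsmul c k hk =>
    simp only [map_smul, Submodule.Quotient.mk_smul, ← TensorProduct.smul_tmul', smul_assoc,
      TensorProduct.tmul_smul, hk]
  | hd d =>
    by_cases h : d.through = t
    · obtain ⟨g, rfl⟩ := Diagram.exists_eq_ofPerm_of_through_eq h
      rw [permPart_ofPerm, Submodule.Quotient.eq]
      exact Submodule.subset_span ⟨_, g, v, rfl⟩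
    · have hlt : d.through < t := lt_of_le_of_ne d.through_le h
      rw [permPart_eq_zero K δ t (d := d), BrauerHom.comp_ofDiagram, Submodule.Quotient.mk_smul,
        mk_eq_zero_of_through_lt ((Diagram.through_comp_le_right x d).trans_lt hlt)]
      · simp
      · rintro g rfl
        exact h (Diagram.through_ofPerm g)

/-- For diagrams `x`, `y`, the element `x y*` of the Brauer algebra sends `w` to `x ⊗ s`, where `s`
represents the functional `u ↦ (y ⊗ u, w)` on the Specht module. -/
theorem exists_preForm_eq_and_comp_smul_eq (x y : Diagram r t)
    (w : CellBimodule K δ r t ⊗[K] SpechtModule K T) : ∃ s : SpechtModule K T,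
      (∀ u : SpechtModule K T, preForm K δ r T
        ((Submodule.Quotient.mk (BrauerHom.ofDiagram δ y) : CellBimodule K δ r t) ⊗ₜ[K] u) w =
          groupForm K (Equiv.Perm (Fin t)) u.1 s.1) ∧
      (show BrauerAlgebra K δ r from
        BrauerHom.comp (BrauerHom.ofDiagram δ x) (BrauerHom.flip (BrauerHom.ofDiagram δ y))) •
          (Submodule.Quotient.mk w : CellModule K δ r T) =
        Submodule.Quotient.mk ((Submodule.Quotient.mk (BrauerHom.ofDiagram δ x) :
          CellBimodule K δ r t) ⊗ₜ[K] s) := by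
  induction w using TensorProduct.induction_on with
  | zero => exact ⟨0, by simp, (smul_zero _).trans (by simp)⟩
  | add w w' hw hw' =>
    obtain ⟨s, hs, hs'⟩ := hw
    obtain ⟨s', ht, ht'⟩ := hw'
    refine ⟨s + s', fun u => by simp [hs, ht], ?_⟩
    rw [Submodule.Quotient.mk_add, smul_add, hs', ht', TensorProduct.tmul_add,
      Submodule.Quotient.mk_add]
  | tmul z v =>
    obtain ⟨z, rfl⟩ := Submodule.Quotient.mk_surjective _ z
    refine ⟨diagramPairing K δ r t (BrauerHom.ofDiagram δ y) z • v, fun u => rfl, ?_⟩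
    rw [diagramPairing_apply, ← mk_comp_tmul, ← BrauerHom.comp_assoc]
    rfl

theorem smul_mk_eq_zero_of_through_lt {d : Diagram r r} (h : d.through < t)
    (w : CellModule K δ r T) : BrauerAlgebra.ofDiagram δ d • w = 0 := by
  obtain ⟨w, rfl⟩ := Submodule.Quotient.mk_surjective _ w
  have hz : ∀ z : BrauerHom K δ r t, (Submodule.Quotient.mk (BrauerAlgebra.ofDiagram δ d • z) :
      CellBimodule K δ r t) = 0 := by
    intro z
    induction z using BrauerHom.induction with
    | h0 => simp
    | hadd x y hx hy => rw [smul_add, Submodule.Quotient.mk_add, hx, hy, add_zero]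
    | hsmul c x hx => rw [smul_comm, Submodule.Quotient.mk_smul, hx, smul_zero]
    | hd d' =>
      rw [BrauerAlgebra.ofDiagram_smul, Submodule.Quotient.mk_smul,
        mk_eq_zero_of_through_lt ((Diagram.through_comp_le_left d d').trans_lt h), smul_zero]
  rw [← Submodule.Quotient.mk_smul]
  induction w using TensorProduct.induction_on with
  | zero => simp
  | add w w' hw hw' => rw [smul_add, Submodule.Quotient.mk_add, hw, hw', add_zero]
  | tmul z v =>
    obtain ⟨z, rfl⟩ := Submodule.Quotient.mk_surjective _ z
    rw [TensorProduct.smul_tmul', ← Submodule.Quotient.mk_smul, hz, TensorProduct.zero_tmul,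
      Submodule.Quotient.mk_zero]

theorem comp_flip_ofDiagram (x y : Diagram r t) :
    (show BrauerAlgebra K δ r from
      BrauerHom.comp (BrauerHom.ofDiagram δ x) (BrauerHom.flip (BrauerHom.ofDiagram δ y))) =
      δ ^ x.loops y.flip • BrauerAlgebra.ofDiagram δ (x.comp y.flip) := by
  rw [BrauerHom.flip, BrauerHom.extend_ofDiagram, BrauerHom.comp_ofDiagram]
  rfl

theorem comp_flip_mem_throughIdeal (x y : Diagram r t) :
    (show BrauerAlgebra K δ r from
      BrauerHom.comp (BrauerHom.ofDiagram δ x) (BrauerHom.flip (BrauerHom.ofDiagram δ y))) ∈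
      throughIdeal K δ r t := by
  rw [comp_flip_ofDiagram, mem_throughIdeal]
  exact Submodule.smul_mem _ _ (Submodule.subset_span
    ⟨_, (Diagram.through_comp_le_left x y.flip).trans x.through_le, rfl⟩)

theorem cellPairing_self {y : Diagram r t} (h : y.through = t) :
    cellPairing K δ r t (Submodule.Quotient.mk (BrauerHom.ofDiagram δ y))
      (Submodule.Quotient.mk (BrauerHom.ofDiagram δ y)) = δ ^ y.flip.loops y • 1 := by
  change diagramPairing K δ r t (BrauerHom.ofDiagram δ y) (BrauerHom.ofDiagram δ y) = _
  rw [diagramPairing_apply, BrauerHom.flip, BrauerHom.extend_ofDiagram, BrauerHom.comp_ofDiagram, map_smul,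
    Diagram.flip_comp_self h, permPart_ofPerm]
  rfl

end CellModule

/-! ### Radical and annihilator -/

section Radical

variable {K : Type*} [Field K] {δ : K} {r t : ℕ} {μ : YoungDiagram} {T : Fin t ≃ μ.cells}

theorem smul_eq_zero_of_mem_cellRadical [CharZero K] (hδ : δ ≠ 0) {w : CellModule K δ r T}
    (hw : w ∈ cellRadical K δ r T) {b : BrauerAlgebra K δ r} (hb : b ∈ throughIdeal K δ r t) :
    b • w = 0 := by
  rw [mem_throughIdeal] at hb
  induction hb using Submodule.span_induction with
  | zero => rw [zero_smul]
  | add b b' _ _ hb hb' => rw [add_smul, hb, hb', add_zero]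
  | smul c b _ hb => rw [smul_assoc, hb, smul_zero]
  | mem b h =>
    obtain ⟨d, hd, rfl⟩ := h
    rcases hd.lt_or_eq with hd | hd
    · exact smul_mk_eq_zero_of_through_lt hd w
    · obtain ⟨x, y, rfl⟩ := Diagram.exists_eq_comp_flip hd
      obtain ⟨w, rfl⟩ := Submodule.Quotient.mk_surjective _ w
      obtain ⟨s, hs, hs'⟩ := exists_preForm_eq_and_comp_smul_eq (δ := δ) x y w
      have hs0 : s = 0 := spechtModule_eq_zero fun u => by
        rw [← hs, preForm_comm]
        exact (mem_cellRadical K δ r T).1 hw (Submodule.Quotient.mk _)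
      -- Cutting `d` may create closed loops, but a power of `δ` can be cancelled.
      rw [comp_flip_ofDiagram, smul_assoc, hs0, TensorProduct.tmul_zero,
        Submodule.Quotient.mk_zero] at hs'
      exact (smul_eq_zero.1 hs').resolve_left (pow_ne_zero _ hδ)

theorem mem_cellRadical_of_forall_smul_eq_zero (hδ : δ ≠ 0) {w : CellModule K δ r T}
    (hw : ∀ b ∈ throughIdeal K δ r t, b • w = 0) : w ∈ cellRadical K δ r T := by
  rw [mem_cellRadical]
  intro v
  obtain ⟨w, rfl⟩ := Submodule.Quotient.mk_surjective _ w
  obtain ⟨v, rfl⟩ := Submodule.Quotient.mk_surjective _ v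
  change preForm K δ r T w v = 0
  induction v using TensorProduct.induction_on with
  | zero => simp
  | add v v' hv hv' => rw [map_add, hv, hv', add_zero]
  | tmul y u =>
    obtain ⟨y, rfl⟩ := Submodule.Quotient.mk_surjective _ y
    induction y using BrauerHom.induction with
    | h0 => simp
    | hadd x y hx hy =>
      rw [Submodule.Quotient.mk_add, TensorProduct.add_tmul, map_add, hx, hy, add_zero]
    | hsmul c x hx =>
      rw [Submodule.Quotient.mk_smul, ← TensorProduct.smul_tmul', map_smul, hx, smul_zero]
    | hd y =>
      rcases y.through_le.lt_or_eq with hy | hy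
      · rw [mk_eq_zero_of_through_lt hy, TensorProduct.zero_tmul, map_zero]
      · obtain ⟨s, hs, hs'⟩ := exists_preForm_eq_and_comp_smul_eq (δ := δ) y y w
        rw [hw _ (comp_flip_mem_throughIdeal y y)] at hs'
        rw [preForm_comm, hs]
        -- Pairing `y ⊗ u` with `y ⊗ s = 0` gives a power of `δ` times `(u, s)`.
        have h := cellForm_mk_tmul K δ r T (Submodule.Quotient.mk (BrauerHom.ofDiagram δ y))
          (Submodule.Quotient.mk (BrauerHom.ofDiagram δ y)) u s
        rw [← hs', map_zero, cellPairing_self hy, smul_one_mul, map_smul] at h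
        exact (smul_eq_zero.1 h.symm).resolve_left (pow_ne_zero _ hδ)

end Radical

end BrauerCell

theorem corollary3p2 {K : Type*} [Field K] [CharZero K] (δ : K) (hδ : δ ≠ 0) (r t : ℕ)
    (htr : t ≤ r) (hpar : t % 2 = r % 2) (μ : YoungDiagram) (T : Fin t ≃ μ.cells) :
    (BrauerCell.cellRadical K δ r T : Set (BrauerCell.CellModule K δ r T)) =
      {w | ∀ b ∈ BrauerCell.throughIdeal K δ r t, b • w = 0} :=
  Set.Subset.antisymm
    (fun _ hw _ hb => BrauerCell.smul_eq_zero_of_mem_cellRadical hδ hw hb)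
    fun _ hw => BrauerCell.mem_cellRadical_of_forall_smul_eq_zero hδ hw
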